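/- Words over $\{\mathtt L,\mathtt R\}$ are the nodes of the full binary tree ($\varepsilon$ is the root, $v\mathtt L$ and $v\mathtt R$ are the children of $v$). For a finite alphabet $A$, a total tree over $A$ is a function $t\colon\{\mathtt L,\mathtt R\}^*\to A$; the set of total trees carries the topology generated by the sets $\{t : t(v)=a\}$ with $v\in\{\mathtt L,\mathtt R\}^*$, $a\in A$. In a parity game, an infinite play is won by $\exists$ if the least priority occurring infinitely often is even, and by $\forall$ otherwise. Let $i,j\in\mathbb N$ with $j\ge i+2$. *Game language.* Let $A_{i,j}=\{\exists,\forall\}\times\{i,\dots,j\}$. A total tree $t$ over $A_{i,j}$ defines a parity game $\mathcal G_t$ with positions $\{\mathtt L,\mathtt R\}^*$ and initial position $\varepsilon$: if $t(v)=(P,n)$, then $v$ has priority $n$ and player $P$ moves from $v$ to $v\mathtt L$ or $v\mathtt R$. Let $W_{i,j}$ be the set of total trees $t$ over $A_{i,j}$ such that $\exists$ has a winning strategy in $\mathcal G_t$. *Edelweiss language.* Let $\widehat A_{i,j}=\{i,i+1,\dots,j-3,e,a\}$. A total tree $t$ over $\widehat A_{i,j}$ defines a parity game $\widehat{\mathcal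 G}_t$ with positions $\{\mathtt L,\mathtt R\}^*$ and initial position $\varepsilon$ (whose priority is irrelevant). If $t(v)=r\in\{i,\dots,j-3\}$, the only move from $v$ is to $v\mathtt L$, which has priority $r$. If $t(v)=e$, player $\exists$ moves from $v$ to $v\mathtt L$ or $v\mathtt R$; if $t(v)=a$, player $\forall$ does. If $j$ is even, the priorities of $v\mathtt L,v\mathtt R$ are $j-1,j$ when $t(v)=a$ and $j-2,j-1$ when $t(v)=e$; if $j$ is odd, they are $j-1,j$ when $t(v)=e$ and $j-2,j-1$ when $t(v)=a$. Let $\widehat W_{i,j}$ be the set of total trees $t$ over $\widehat A_{i,j}$ such that $\exists$ has a winning strategy in $\widehat{\mathcal G}_t$. **Proposition.** For all $i,j\in\mathbb N$ with $j\ge i+2$, $W_{i,j}\le_W\widehat W_{i,j}$; that is, there is a continuous function $f$ from total trees over $A_{i,j}$ to total trees over $\widehat A_{i,j}$ with $f^{-1}(\widehat W_{i,j})=W_{i,j}$. -/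

import Mathlib

open Filter

/-- The two directions, left and right. -/
inductive Dir
  | L
  | R

/-- The two players of a game. -/
inductive Player
  | exist
  | univ

/-- Nodes of the full binary tree: words over `{L, R}`, read from the root.
The children of `v` are `v ++ [Dir.L]` and `v ++ [Dir.R]`. -/
abbrev Node := List Dir

instance : Finite Dir :=
  Finite.of_injective (fun d : Dir => match d with | .L => true | .R => false) (by
    intro x y h; cases x <;> cases y <;> simp_all)

/-- Total (full binary, infinite) trees labelled by letters from `A`. -/
def TotalTree (A : Type*) := Node → A

/-- The Cantor-like topology, generated by the sets `{t | t v = a}`. -/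
instance (A : Type*) : TopologicalSpace (TotalTree A) :=
  TopologicalSpace.generateFrom {s | ∃ (v : Node) (a : A), s = {t : TotalTree A | t v = a}}

/-- Continuous (Wadge) reducibility of `L₁ ⊆ X` to `L₂ ⊆ Y`. -/
def ContinuouslyReduces {X Y : Type*} [TopologicalSpace X] [TopologicalSpace Y]
    (L₁ : Set X) (L₂ : Set Y) : Prop :=
  ∃ f : X → Y, Continuous f ∧ f ⁻¹' L₂ = L₁

/-- Parity games without final positions on a countable arena, finitely branching,
without dead ends, and with bounded priorities. -/
structure ParityGame (V : Type*) [Countable V] where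
  owner : V → Player
  init : V
  edge : V → V → Prop
  priority : V → ℕ
  finite_branching : ∀ v, {w | edge v w}.Finite
  no_dead_end : ∀ v, ∃ w, edge v w
  bounded_priority : ∃ N, ∀ v, priority v ≤ N

namespace ParityGame

variable {V : Type*} [Countable V] (G : ParityGame V)

/-- An infinite play from the initial position. -/
def IsPlay (π : ℕ → V) : Prop :=
  π 0 = G.init ∧ ∀ n, G.edge (π n) (π (n + 1))

/-- A positional strategy for player `P`: a legal move at each position of `P`
(the values of `σ` at positions of the opponent are never used). -/
def IsStrategy (P : Player) (σ : V → V) : Prop :=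
  ∀ v, G.owner v = P → G.edge v (σ v)

/-- The play `π` conforms to the strategy `σ` of player `P`. -/
def Conforms (P : Player) (σ : V → V) (π : ℕ → V) : Prop :=
  ∀ n, G.owner (π n) = P → π (n + 1) = σ (π n)

/-- The lowest priority seen infinitely often in `π` is even. -/
def WonByExist (π : ℕ → V) : Prop :=
  Even (liminf (fun n => G.priority (π n)) atTop)

/-- Player `∃` has a winning strategy. -/
def ExistHasWinningStrategy : Prop :=
  ∃ σ : V → V, G.IsStrategy Player.exist σ ∧
    ∀ π : ℕ → V, G.IsPlay π → G.Conforms Player.exist σ π → G.WonByExist π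

end ParityGame

/-- The alphabet `{∃, ∀} × {i, …, j}`. -/
abbrev GameLetter (i j : ℕ) := Player × Set.Icc i j

/-- The parity game encoded by a tree over `{∃, ∀} × {i, …, j}`: the label of a node gives
the owner and the priority of the node, and its owner moves to one of its children. -/
def treeGame {i j : ℕ} (t : TotalTree (GameLetter i j)) : ParityGame Node where
  owner v := (t v).1
  init := []
  edge v w := ∃ d : Dir, w = v ++ [d]
  priority v := ((t v).2 : ℕ)
  finite_branching v :=
    (Set.finite_range fun d : Dir => v ++ [d]).subset (by rintro w ⟨d, rfl⟩; exact ⟨d, rfl⟩)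
  no_dead_end v := ⟨v ++ [Dir.L], Dir.L, rfl⟩
  bounded_priority := ⟨j, fun v => (t v).2.2.2⟩

/-- The game language `W_{i,j}`. -/
def gameLanguage (i j : ℕ) : Set (TotalTree (GameLetter i j)) :=
  {t | (treeGame t).ExistHasWinningStrategy}

/-- The edelweiss alphabet `{i, i+1, …, j-3, e, a}`, for `i + 2 ≤ j`. -/
inductive EdelLetter (i j : ℕ)
  | num (r : ℕ) (hi : i ≤ r) (hj : r + 3 ≤ j)
  | e
  | a

namespace EdelLetter

variable {i j : ℕ}

/-- The owner of a node with a given label (irrelevant for `num`, where there is one move). -/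
def owner : EdelLetter i j → Player
  | num _ _ _ => Player.exist
  | e => Player.exist
  | a => Player.univ

/-- The directions in which one can move from a node with a given label. -/
def allows : EdelLetter i j → Dir → Prop
  | num _ _ _, Dir.L => True
  | num _ _ _, Dir.R => False
  | e, _ => True
  | a, _ => True

/-- The priority of the left or right child of a node with a given label. The right child of
a `num` node is unreachable, so its priority does not matter. -/
def childPriority : EdelLetter i j → Dir → ℕ
  | num r _ _, Dir.L => r
  | num _ _ _, Dir.R => j
  | e, Dir.L => if Even j then j - 2 else j - 1
  | e, Dir.R => if Even j then j - 1 else j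
  | a, Dir.L => if Even j then j - 1 else j - 2
  | a, Dir.R => if Even j then j else j - 1

theorem childPriority_le (x : EdelLetter i j) (d : Dir) : x.childPriority d ≤ j := by
  cases x <;> cases d <;> simp only [childPriority] <;> (try split_ifs) <;> omega

end EdelLetter

/-- Priorities in the edelweiss game: the priority of `u ++ [d]` is determined by the label of
`u` and by `d`; the root, which is visited only once, gets priority `j`. -/
def edelPriority {i j : ℕ} (t : TotalTree (EdelLetter i j)) (v : Node) : ℕ :=
  match v.getLast? with
  | none => j
  | some d => (t v.dropLast).childPriority d

/-- The parity game encoded by a tree over the edelweiss alphabet. -/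
def edelGame {i j : ℕ} (t : TotalTree (EdelLetter i j)) : ParityGame Node where
  owner v := (t v).owner
  init := []
  edge v w := ∃ d : Dir, (t v).allows d ∧ w = v ++ [d]
  priority := edelPriority t
  finite_branching v :=
    (Set.finite_range fun d : Dir => v ++ [d]).subset (by rintro w ⟨d, _, rfl⟩; exact ⟨d, rfl⟩)
  no_dead_end v := ⟨v ++ [Dir.L], Dir.L, by cases t v <;> trivial, rfl⟩
  bounded_priority := ⟨j, fun v => by
    unfold edelPriority
    split
    · exact le_rfl
    · exact EdelLetter.childPriority_le _ _⟩

/-- The edelweiss language `Ŵ_{i,j}`, for `i + 2 ≤ j`. -/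
def edelweissLanguage (i j : ℕ) : Set (TotalTree (EdelLetter i j)) :=
  {t | (edelGame t).ExistHasWinningStrategy}

/-! Call exiter the player who likes `j` and `j - 2`, and claimer the one who likes `j - 1`. The
edelweiss letters give the claimer a choice between `j - 1` and `j` and the exiter a choice between
`j - 2` and `j - 1`; a priority up to `j - 3` can be displayed directly. In the original game,
however, a node of priority `j - 1` or `j` may belong to either player. Stretches of play with
priorities at least `j - 1` are therefore not copied but replaced by finite claims. After an exit
`x` with frontier `F`, the claimer names a finite set `T` and a bound `k`, asserting that from each
node of `F` the play can be forced into `T` within `k + 1` steps, where the nodes of `T` have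
priority below `j` and the nodes strictly between `x` and `T` have priority at least `j - 1`.
Whether a claim is correct depends on a finite part of the tree, so the encoding is continuous, and
a false claim hands the win to the exiter. The exiter may then leave to a node of `T` of priority at
most `j - 2`, which is displayed; if every such node is declined, the nodes of `T` of priority `j -
1` form the next frontier. Postponing a claim shows `j`, making one shows `j - 1`.

If there are infinitely many exits, they lie on one branch of the original tree, and that branch and
the run have the same least recurring priority (`Stage.Run.parityWon_of_frequently`). If there are
finitely many and nobody forfeits, the claimer wins exactly by claiming infinitely often. A claimer
with a winning strategy can always do so: by König's lemma the strategy forces a priority below `j`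
within boundedly many steps (`finiteHit_of_winning`, `exists_validClaim`). An exiter with a winning
strategy always keeps in sight a node consistent with it; infinitely many correct claims without an
exit would yield a consistent branch on which `j - 1` recurs and nothing smaller does
(`Stage.exiter_wonBy_encode`). The two transfers give an equivalence because the original game is
determined (`parity_determined`), which is proved by nested fixed points. -/

/-! ### Players, parity conditions and winners -/

namespace Player

/-- The opponent. -/
def other : Player → Player
  | exist => univ
  | univ => exist

/-- Player `P` likes the priority `m`. -/
def Favours : Player → ℕ → Prop
  | exist, m => Even m
  | univ, m => ¬ Even m

theorem other_favours (P : Player) (m : ℕ) : P.other.Favours m ↔ ¬ P.Favours m := by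
  cases P <;> simp [other, Favours]

theorem eq_other_iff (P Q : Player) : Q = P.other ↔ Q ≠ P := by
  cases P <;> cases Q <;> simp [other]

theorem favours_add_two (P : Player) (m : ℕ) : P.Favours (m + 2) ↔ P.Favours m := by
  cases P <;> simp [Favours, Nat.even_add]

theorem favours_succ (P : Player) (m : ℕ) : P.Favours (m + 1) ↔ ¬ P.Favours m := by
  cases P <;> simp [Favours, Nat.even_add_one]

end Player

/-- The least value that `p` takes infinitely often exists and is liked by `P`. -/
def ParityWon (P : Player) (p : ℕ → ℕ) : Prop :=
  ∃ m, P.Favours m ∧ (∃ᶠ n in atTop, p n = m) ∧ ∀ᶠ n in atTop, m ≤ p n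

theorem liminf_eq_of_frequently {p : ℕ → ℕ} {m : ℕ} (h₁ : ∃ᶠ n in atTop, p n = m)
    (h₂ : ∀ᶠ n in atTop, m ≤ p n) : liminf p atTop = m := by
  have key : ∀ a, (∀ᶠ n in atTop, a ≤ p n) → a ≤ m := fun a ha => by
    obtain ⟨n, hn, hn'⟩ := (h₁.and_eventually ha).exists
    omega
  rw [liminf_eq]
  exact le_antisymm (csSup_le ⟨m, h₂⟩ key) (le_csSup ⟨m, key⟩ h₂)

theorem exists_frequently_min {p : ℕ → ℕ} {B : ℕ} (hB : ∀ n, p n ≤ B) :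
    ∃ m, (∃ᶠ n in atTop, p n = m) ∧ ∀ᶠ n in atTop, m ≤ p n := by
  classical
  have hex : ∃ m, ∃ᶠ n in atTop, p n = m := by
    by_contra! h
    have := (Finset.range (B + 1)).eventually_all (l := atTop)
      (p := fun m n => ¬ p n = m) |>.2 (fun m _ => h m)
    obtain ⟨n, hn⟩ := this.exists
    exact hn (p n) (by simpa [Nat.lt_succ_iff] using hB n) rfl
  refine ⟨Nat.find hex, Nat.find_spec hex, ?_⟩
  have := (Finset.range (Nat.find hex)).eventually_all (l := atTop)
      (p := fun m n => ¬ p n = m) |>.2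
      (fun m hm => not_frequently.1 (Nat.find_min hex (Finset.mem_range.1 hm)))
  filter_upwards [this] with n hn
  by_contra! hlt
  exact hn (p n) (Finset.mem_range.2 hlt) rfl

theorem parityWon_iff_favours_liminf {P : Player} {p : ℕ → ℕ} {B : ℕ} (hB : ∀ n, p n ≤ B) :
    ParityWon P p ↔ P.Favours (liminf p atTop) := by
  constructor
  · rintro ⟨m, hm, h₁, h₂⟩
    rwa [liminf_eq_of_frequently h₁ h₂]
  · intro h
    obtain ⟨m, h₁, h₂⟩ := exists_frequently_min hB
    exact ⟨m, liminf_eq_of_frequently h₁ h₂ ▸ h, h₁, h₂⟩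

theorem ParityWon.favours {P : Player} {p : ℕ → ℕ} {m : ℕ} (h : ParityWon P p)
    (h₁ : ∃ᶠ n in atTop, p n = m) (h₂ : ∀ᶠ n in atTop, m ≤ p n) : P.Favours m := by
  obtain ⟨m', hm', h₁', h₂'⟩ := h
  rw [← liminf_eq_of_frequently h₁ h₂, liminf_eq_of_frequently h₁' h₂']
  exact hm'

theorem not_parityWon_both {P : Player} {p : ℕ → ℕ} (h : ParityWon P p)
    (h' : ParityWon P.other p) : False := by
  obtain ⟨m, hm, h₁, h₂⟩ := h
  exact (P.other_favours m).1 (h'.favours h₁ h₂) hm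

theorem parityWon_succ {P : Player} {p : ℕ → ℕ} (h : ParityWon P fun n => p (n + 1)) :
    ParityWon P p := by
  obtain ⟨m, hm, h₁, h₂⟩ := h
  exact ⟨m, hm, (tendsto_add_atTop_nat 1).frequently h₁,
    by rwa [← eventually_map (m := fun n => n + 1) (P := fun n => m ≤ p n),
      map_add_atTop_eq_nat] at h₂⟩

namespace ParityGame

variable {V : Type*} [Countable V] (G : ParityGame V)

/-- Player `P` has a winning strategy. -/
def WonBy (P : Player) : Prop :=
  ∃ σ : V → V, G.IsStrategy P σ ∧
    ∀ π : ℕ → V, G.IsPlay π → G.Conforms P σ π → ParityWon P fun n => G.priority (π n)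

theorem wonBy_exist_iff : G.WonBy Player.exist ↔ G.ExistHasWinningStrategy := by
  obtain ⟨B, hB⟩ := G.bounded_priority
  have h := fun π : ℕ → V => parityWon_iff_favours_liminf (P := Player.exist)
    (fun n => hB (π n))
  simp only [WonBy, ExistHasWinningStrategy, WonByExist, h, Player.Favours]

/-- Playing the two strategies against each other gives a single play that both players would win.
-/
theorem not_wonBy_both {P : Player} (h : G.WonBy P) (h' : G.WonBy P.other) : False := by
  classical
  obtain ⟨σ, hσ, hw⟩ := h
  obtain ⟨τ, hτ, hw'⟩ := h'
  let next : V → V := fun v => if G.owner v = P then σ v else τ v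
  let π : ℕ → V := fun n => next^[n] G.init
  have hs : ∀ n, π (n + 1) = next (π n) := fun n => Function.iterate_succ_apply' _ _ _
  have hplay : G.IsPlay π := ⟨rfl, fun n => by
    rw [hs]
    by_cases h : G.owner (π n) = P
    · simpa only [next, h, if_true] using hσ _ h
    · simpa only [next, h, if_false] using hτ _ ((Player.eq_other_iff _ _).2 h)⟩
  refine not_parityWon_both (hw π hplay fun n hn => ?_) (hw' π hplay fun n hn => ?_)
  · rw [hs]; simp only [next, hn, if_true]
  · rw [hs]; simp only [next, (Player.eq_other_iff _ _).1 hn, if_false]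

end ParityGame

/-! ### Branches of the binary tree -/

instance : Nonempty Dir := ⟨Dir.L⟩

/-- The node reached from the root by the first `n` directions of `β`. -/
def branch (β : ℕ → Dir) : ℕ → Node
  | 0 => []
  | n + 1 => branch β n ++ [β n]

theorem length_branch (β : ℕ → Dir) (n : ℕ) : (branch β n).length = n := by
  induction n with
  | zero => rfl
  | succ n ih => simp [branch, ih]

theorem take_branch (β : ℕ → Dir) {l n : ℕ} (h : l ≤ n) : (branch β n).take l = branch β l := by
  induction n with
  | zero => obtain rfl : l = 0 := by omega
            rfl
  | succ n ih =>
    rcases h.eq_or_lt with rfl | h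
    · rw [List.take_of_length_le (length_branch β _).le]
    · rw [branch, List.take_append_of_le_length (by rw [length_branch]; omega), ih (by omega)]

theorem exists_branch {π : ℕ → Node} (h₀ : π 0 = []) (h : ∀ n, ∃ d, π (n + 1) = π n ++ [d]) :
    ∃ β, ∀ n, π n = branch β n := by
  choose β hβ using h
  refine ⟨β, fun n => ?_⟩
  induction n with
  | zero => exact h₀
  | succ n ih => rw [hβ, ih, branch]

/-! ### Determinacy of parity games on the binary tree -/

section Determinacy

variable (own : Node → Player) (pr : Node → ℕ)

/-- The nodes from which player `P` can enforce that the next node is in `Y`. -/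
def controlSet (P : Player) (Y : Set Node) : Set Node :=
  {v | (own v = P → ∃ d, v ++ [d] ∈ Y) ∧ (own v ≠ P → ∀ d, v ++ [d] ∈ Y)}

theorem notMem_controlSet_iff {P : Player} {Y : Set Node} {v : Node} :
    v ∉ controlSet own P Y ↔ v ∈ controlSet own P.other Yᶜ := by
  by_cases h : own v = P
  · have h' : own v ≠ P.other := by rw [Ne, Player.eq_other_iff, not_not]; exact h
    simp only [controlSet, Set.mem_ofPred_eq, h, forall_const, ne_eq, not_true_eq_false,
      IsEmpty.forall_iff, and_true, not_exists]
    rw [h] at h'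
    simp [h']
  · have h' : own v = P.other := (Player.eq_other_iff _ _).2 h
    have h'' : P.other ≠ P := (Player.eq_other_iff _ _).1 rfl
    simp [controlSet, h', h'']

/-- The winning region of `P` as a nested fixed point. With `m` fixed points the priorities
`j + 1 - m, …, j` are treated as in a parity game, and a node of lower priority `n` ends the
play, which is won if the node is in `X n`. -/
def winSet (j : ℕ) (P : Player) : ℕ → (ℕ → Set Node) → Set Node
  | 0, X => controlSet own P {w | w ∈ X (pr w)}
  | m + 1, X =>
    {v | (P.Favours (j - m) → ∃ Y, Y ⊆ winSet j P m (Function.update X (j - m) Y) ∧ v ∈ Y) ∧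
      (¬ P.Favours (j - m) → ∀ Y, winSet j P m (Function.update X (j - m) Y) ⊆ Y → v ∈ Y)}

/-- Complementation exchanges the one-step control of the two players and turns least fixed points
into greatest ones. This is the source of determinacy: what lies outside the region of one player
lies in the region of the other. -/
theorem notMem_winSet_iff (j : ℕ) (P : Player) (m : ℕ) (X : ℕ → Set Node) (v : Node) :
    v ∉ winSet own pr j P m X ↔ v ∈ winSet own pr j P.other m fun n => (X n)ᶜ := by
  induction m generalizing X v with
  | zero => exact notMem_controlSet_iff own
  | succ m ih =>
    have hup : ∀ Y : Set Node, Function.update (fun n => (X n)ᶜ) (j - m) Yᶜ =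
        fun n => (Function.update X (j - m) Y n)ᶜ := fun Y => by
      funext n
      by_cases hn : n = j - m
      · subst hn; simp
      · simp [hn]
    have hc : ∀ Y : Set Node,
        winSet own pr j P.other m (Function.update (fun n => (X n)ᶜ) (j - m) Yᶜ) =
          (winSet own pr j P m (Function.update X (j - m) Y))ᶜ := fun Y => by
      ext w
      rw [hup, ← ih, Set.mem_compl_iff]
    by_cases hF : P.Favours (j - m)
    · simp only [winSet, Set.mem_ofPred_eq, Player.other_favours, hF, forall_const,
        not_true_eq_false, IsEmpty.forall_iff, and_true, not_false_eq_true, true_and, not_exists,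
        not_and]
      -- The quantifier over `Y` is reindexed by complements.
      refine Iff.trans ?_ (compl_surjective (α := Set Node)).forall.symm
      simp only [hc, Set.compl_subset_compl, Set.mem_compl_iff]
    · simp only [winSet, Set.mem_ofPred_eq, Player.other_favours, hF, forall_const,
        not_true_eq_false, IsEmpty.forall_iff, and_true, not_false_eq_true, true_and, not_forall]
      refine Iff.trans ?_ (compl_surjective (α := Set Node)).exists.symm
      simp only [hc, Set.compl_subset_compl, Set.mem_compl_iff, exists_prop]

/-- Following `σ` from `v`, player `P` wins each play on which only priorities `≥ k` occur, and
the first node of a priority `n < k`, if there is one, is in `X n`. -/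
def Secures (P : Player) (k : ℕ) (X : ℕ → Set Node) (v : Node) (σ : Node → Dir) : Prop :=
  ∀ β, branch β v.length = v →
    (∀ N, v.length < N →
      (∀ n, v.length ≤ n → n < N → own (branch β n) = P → β n = σ (branch β n)) →
      (∀ n, v.length < n → n < N → k ≤ pr (branch β n)) → pr (branch β N) < k →
      branch β N ∈ X (pr (branch β N))) ∧
    ((∀ n, v.length ≤ n → own (branch β n) = P → β n = σ (branch β n)) →
      (∀ n, v.length < n → k ≤ pr (branch β n)) → ParityWon P fun n => pr (branch β n))

variable {own pr}

/-- Every child has priority below the threshold `j + 1`, so a single controlled move already ends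
the play. -/
theorem exists_secures_of_mem_controlSet {P : Player} {j : ℕ} (hj : ∀ v, pr v ≤ j)
    {X : ℕ → Set Node} {v : Node} (hv : v ∈ controlSet own P {w | w ∈ X (pr w)}) :
    ∃ σ, Secures own pr P (j + 1) X v σ := by
  have hd : ∃ d, own v = P → v ++ [d] ∈ X (pr (v ++ [d])) := by
    by_cases h : own v = P
    · obtain ⟨d, hd⟩ := hv.1 h
      exact ⟨d, fun _ => hd⟩
    · exact ⟨Dir.L, fun h' => absurd h' h⟩
  obtain ⟨d, hd⟩ := hd
  refine ⟨fun _ => d, fun β hβ => ⟨fun N hN hc hk _ => ?_, fun _ hk => ?_⟩⟩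
  · obtain rfl : N = v.length + 1 := by
      by_contra hne
      have h₁ := hk (v.length + 1) (by omega) (by omega)
      have h₂ := hj (branch β (v.length + 1))
      omega
    rw [branch, hβ]
    by_cases h : own v = P
    · rw [hc _ le_rfl (by omega) (by rwa [hβ])]
      exact hd h
    · exact hv.2 h _
  · have h₁ := hk (v.length + 1) (by omega)
    have h₂ := hj (branch β (v.length + 1))
    omega

/-- Follow a strategy up to the first node of priority `k`, then switch. -/
theorem exists_secures_of_switch {P : Player} {k : ℕ} {X : ℕ → Set Node} {S : Set Node}
    (hS : ∀ w ∈ S, ∃ σ, Secures own pr P k X w σ) {v : Node} {σ : Node → Dir}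
    (hσ : Secures own pr P (k + 1) (Function.update X k S) v σ) :
    ∃ τ, Secures own pr P k X v τ := by
  classical
  choose! s hs using hS
  -- The switch takes place at the first node of priority `k` strictly below `v`; the priority of
  -- `v` itself is not inspected.
  let τ : Node → Dir := fun u =>
    if h : ∃ l, v.length < l ∧ l ≤ u.length ∧ pr (u.take l) = k then
      s (u.take (Nat.find h)) u else σ u
  have h₀ : ∀ β n, (∀ l, v.length < l → l ≤ n → pr (branch β l) ≠ k) →
      τ (branch β n) = σ (branch β n) := by
    intro β n h
    refine dif_neg ?_
    rintro ⟨l, hl, hl', hl''⟩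
    rw [length_branch] at hl'
    rw [take_branch β hl'] at hl''
    exact h l hl hl' hl''
  have h₁ : ∀ β n₀ n, v.length < n₀ → n₀ ≤ n → pr (branch β n₀) = k →
      (∀ l, v.length < l → l < n₀ → pr (branch β l) ≠ k) →
      τ (branch β n) = s (branch β n₀) (branch β n) := by
    intro β n₀ n hv hn hk hmin
    have hex : ∃ l, v.length < l ∧ l ≤ (branch β n).length ∧ pr ((branch β n).take l) = k :=
      ⟨n₀, hv, by rwa [length_branch], by rwa [take_branch β hn]⟩
    have hfind : Nat.find hex = n₀ := by
      rw [Nat.find_eq_iff]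
      refine ⟨⟨hv, by rwa [length_branch], by rwa [take_branch β hn]⟩, ?_⟩
      rintro l hl ⟨hl₁, _, hl₂⟩
      rw [take_branch β (by omega)] at hl₂
      exact hmin l hl₁ hl hl₂
    change dite _ _ _ = _
    rw [dif_pos hex, hfind, take_branch β hn]
  refine ⟨τ, fun β hβ => ?_⟩
  obtain ⟨hσ₁, hσ₂⟩ := hσ β hβ
  have hmem : ∀ n₀, v.length < n₀ → pr (branch β n₀) = k →
      (∀ l, v.length < l → l < n₀ → k ≤ pr (branch β l)) →
      (∀ l, v.length < l → l < n₀ → pr (branch β l) ≠ k) →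
      (∀ n, v.length ≤ n → n < n₀ → own (branch β n) = P → β n = τ (branch β n)) →
      Secures own pr P k X (branch β n₀) (s (branch β n₀)) := by
    intro n₀ hv hk hge hne hc
    have := hσ₁ n₀ hv (fun n hn hn' ho => by
      rw [hc n hn hn' ho, h₀]
      intro l hl hl'
      exact hne l hl (by omega)) (fun n hn hn' => lt_of_le_of_ne (hge n hn hn') (hne n hn hn').symm)
      (by omega)
    rw [hk, Function.update_self] at this
    exact hs _ this
  constructor
  · intro N hN hc hge hlt
    by_cases hex : ∃ n₀, v.length < n₀ ∧ n₀ < N ∧ pr (branch β n₀) = k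
    · obtain ⟨hv, hn, hk⟩ := Nat.find_spec hex
      have hmin : ∀ l, v.length < l → l < Nat.find hex → pr (branch β l) ≠ k :=
        fun l hl hl' hk' => Nat.find_min hex hl' ⟨hl, by omega, hk'⟩
      generalize Nat.find hex = n₀ at hv hn hk hmin
      refine ((hmem n₀ hv hk (fun l hl hl' => hge l hl (by omega)) hmin
        (fun n hn hn' => hc n hn (by omega))) β (by rw [length_branch])).1 N ?_ ?_ ?_ hlt
      · rwa [length_branch]
      · intro n hn' hn'' ho
        rw [length_branch] at hn'
        rw [hc n (by omega) hn'' ho, h₁ β n₀ n hv hn' hk hmin]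
      · intro n hn' hn''
        rw [length_branch] at hn'
        exact hge n (by omega) hn''
    · push Not at hex
      have := hσ₁ N hN (fun n hn hn' ho => by
        rw [hc n hn hn' ho, h₀]
        intro l hl hl'
        exact hex l hl (by omega))
        (fun n hn hn' => lt_of_le_of_ne (hge n hn hn') (hex n hn hn').symm)
        (by omega)
      rwa [Function.update_of_ne (by omega)] at this
  · intro hc hge
    by_cases hex : ∃ n₀, v.length < n₀ ∧ pr (branch β n₀) = k
    · obtain ⟨hv, hk⟩ := Nat.find_spec hex
      have hmin : ∀ l, v.length < l → l < Nat.find hex → pr (branch β l) ≠ k :=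
        fun l hl hl' hk' => Nat.find_min hex hl' ⟨hl, hk'⟩
      generalize Nat.find hex = n₀ at hv hk hmin
      refine ((hmem n₀ hv hk (fun l hl hl' => hge l hl) hmin
        (fun n hn hn' => hc n hn)) β (by rw [length_branch])).2 ?_ ?_
      · intro n hn' ho
        rw [length_branch] at hn'
        rw [hc n (by omega) ho, h₁ β n₀ n hv hn' hk hmin]
      · intro n hn'
        rw [length_branch] at hn'
        exact hge n (by omega)
    · push Not at hex
      exact hσ₂ (fun n hn ho => by
        rw [hc n hn ho, h₀]
        intro l hl hl'
        exact hex l hl) (fun n hn => lt_of_le_of_ne (hge n hn) (hex n hn).symm)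

/-- Switch to a new strategy at each node of priority `k`. -/
theorem exists_secures_of_forall {P : Player} {k : ℕ} (hP : P.Favours k) {X : ℕ → Set Node}
    {Y : Set Node} (hY : ∀ w ∈ Y, ∃ σ, Secures own pr P (k + 1) (Function.update X k Y) w σ)
    {v : Node} (hv : v ∈ Y) : ∃ τ, Secures own pr P k X v τ := by
  classical
  choose! s hs using hY
  -- The strategy in force is the one attached to the last node of priority `k` strictly below `v`
  -- on the path, or to `v` if there is none.
  let τ : Node → Dir := fun u => s (u.take (Nat.findGreatest
    (fun l => v.length ≤ l ∧ (l = v.length ∨ pr (u.take l) = k)) u.length)) u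
  have hτ : ∀ β n₀ n, v.length ≤ n₀ → n₀ ≤ n → (n₀ = v.length ∨ pr (branch β n₀) = k) →
      (∀ l, n₀ < l → l ≤ n → pr (branch β l) ≠ k) →
      τ (branch β n) = s (branch β n₀) (branch β n) := by
    intro β n₀ n hn₀ hn hk hmax
    have hfind : Nat.findGreatest (fun l => v.length ≤ l ∧
        (l = v.length ∨ pr ((branch β n).take l) = k)) (branch β n).length = n₀ := by
      rw [Nat.findGreatest_eq_iff, length_branch]
      refine ⟨hn, fun _ => ⟨hn₀, by rwa [take_branch β hn]⟩, ?_⟩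
      rintro l hl hl' ⟨_, hl'' | hl''⟩
      · omega
      · rw [take_branch β hl'] at hl''
        exact hmax l hl hl' hl''
    change s _ _ = _
    rw [hfind, take_branch β hn]
  refine ⟨τ, fun β hβ => ?_⟩
  have hlast : ∀ n, v.length ≤ n → ∃ n₀, v.length ≤ n₀ ∧ n₀ ≤ n ∧
      (n₀ = v.length ∨ pr (branch β n₀) = k) ∧ ∀ l, n₀ < l → l ≤ n → pr (branch β l) ≠ k := by
    intro n hn
    induction n, hn using Nat.le_induction with
    | base => exact ⟨_, le_rfl, le_rfl, Or.inl rfl, fun l _ _ => by omega⟩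
    | succ n hn ih =>
      by_cases hk : pr (branch β (n + 1)) = k
      · exact ⟨n + 1, by omega, le_rfl, Or.inr hk, fun l _ _ => by omega⟩
      · obtain ⟨n₀, h₁, h₂, h₃, h₄⟩ := ih
        refine ⟨n₀, h₁, by omega, h₃, fun l hl hl' => ?_⟩
        rcases hl'.eq_or_lt with rfl | hl'
        · exact hk
        · exact h₄ l hl (by omega)
  -- Every node at which the strategy restarts lies in `Y`, because the strategy in force since the
  -- previous restart secures this.
  have hmem : ∀ n, v.length ≤ n →
      (∀ l, v.length ≤ l → l < n → own (branch β l) = P → β l = τ (branch β l)) →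
      (∀ l, v.length < l → l < n → k ≤ pr (branch β l)) →
      (n = v.length ∨ pr (branch β n) = k) → branch β n ∈ Y := by
    intro n
    induction n using Nat.strong_induction_on with
    | _ n ih =>
      intro hn hc hge hk
      rcases hn.eq_or_lt with rfl | hn
      · rwa [hβ]
      obtain ⟨n₀, h₁, h₂, h₃, h₄⟩ := hlast (n - 1) (by omega)
      have hY := ih n₀ (by omega) h₁ (fun l hl hl' => hc l hl (by omega))
        (fun l hl hl' => hge l hl (by omega)) h₃
      have := ((hs _ hY) β (by rw [length_branch])).1 n (by rw [length_branch]; omega)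
        (fun l hl hl' ho => by
          rw [length_branch] at hl
          rw [hc l (by omega) hl' ho, hτ β n₀ l h₁ hl h₃ fun l' h h' => h₄ l' h (by omega)])
        (fun l hl hl' => by
          rw [length_branch] at hl
          exact lt_of_le_of_ne (hge l (by omega) hl') (h₄ l hl (by omega)).symm)
        (by omega)
      rwa [hk.resolve_left (by omega), Function.update_self] at this
  constructor
  · intro N hN hc hge hlt
    obtain ⟨n₀, h₁, h₂, h₃, h₄⟩ := hlast (N - 1) (by omega)
    have hY := hmem n₀ h₁ (fun l hl hl' => hc l hl (by omega))
      (fun l hl hl' => hge l hl (by omega)) h₃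
    have := ((hs _ hY) β (by rw [length_branch])).1 N (by rw [length_branch]; omega)
      (fun l hl hl' ho => by
        rw [length_branch] at hl
        rw [hc l (by omega) hl' ho, hτ β n₀ l h₁ hl h₃ fun l' h h' => h₄ l' h (by omega)])
      (fun l hl hl' => by
        rw [length_branch] at hl
        exact lt_of_le_of_ne (hge l (by omega) hl') (h₄ l hl (by omega)).symm)
      (by omega)
    rwa [Function.update_of_ne (by omega)] at this
  · intro hc hge
    -- Either `k` recurs and is then the least recurring priority, or after the last restart a
    -- single strategy is followed forever and wins.
    by_cases hfr : ∃ᶠ n in atTop, pr (branch β n) = k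
    · exact ⟨k, hP, hfr, eventually_atTop.2 ⟨v.length + 1, fun n hn => hge n hn⟩⟩
    · obtain ⟨M, hM⟩ := eventually_atTop.1 (not_frequently.1 hfr)
      obtain ⟨n₀, h₁, h₂, h₃, h₄⟩ := hlast (M + v.length) (by omega)
      have h₄' : ∀ l, n₀ < l → pr (branch β l) ≠ k := fun l hl => by
        rcases le_total l (M + v.length) with h | h
        · exact h₄ l hl h
        · exact hM l (by omega)
      have hY := hmem n₀ h₁ (fun l hl _ => hc l hl) (fun l hl _ => hge l hl) h₃
      refine ((hs _ hY) β (by rw [length_branch])).2 (fun l hl ho => ?_) (fun l hl => ?_)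
      · rw [length_branch] at hl
        rw [hc l (by omega) ho, hτ β n₀ l h₁ hl h₃ fun l' h _ => h₄' l' h]
      · rw [length_branch] at hl
        exact lt_of_le_of_ne (hge l (by omega)) (h₄' l hl).symm

/-- For a greatest fixed point, a post-fixed set allows restarting at each node of that priority.
For a least one, the nodes with a securing strategy form a pre-fixed set, which therefore contains
it. Monotonicity of the operator is never needed. -/
theorem exists_secures_of_mem_winSet {P : Player} {j : ℕ} (hj : ∀ v, pr v ≤ j) {m : ℕ}
    (hm : m ≤ j + 1) {X : ℕ → Set Node} {v : Node} (hv : v ∈ winSet own pr j P m X) :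
    ∃ σ, Secures own pr P (j + 1 - m) X v σ := by
  induction m generalizing X v with
  | zero => exact exists_secures_of_mem_controlSet hj hv
  | succ m ih =>
    have e₁ : j + 1 - (m + 1) = j - m := by omega
    have e₂ : j + 1 - m = j - m + 1 := by omega
    rw [e₁]
    rw [e₂] at ih
    by_cases hF : P.Favours (j - m)
    · obtain ⟨Y, hY, hvY⟩ := hv.1 hF
      exact exists_secures_of_forall hF (fun w hw => ih (by omega) (hY hw)) hvY
    · refine hv.2 hF {v | ∃ σ, Secures own pr P (j - m) X v σ} fun w hw => ?_
      obtain ⟨σ, hσ⟩ := ih (by omega) hw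
      exact exists_secures_of_switch (fun _ h => h) hσ

/-- Parity games on the full binary tree are determined. -/
theorem parity_determined {j : ℕ} (hj : ∀ v, pr v ≤ j) :
    ∃ P : Player, ∃ σ : Node → Dir, ∀ β, (∀ n, own (branch β n) = P → β n = σ (branch β n)) →
      ParityWon P fun n => pr (branch β n) := by
  have key : ∀ P X, [] ∈ winSet own pr j P (j + 1) X → ∃ σ : Node → Dir, ∀ β,
      (∀ n, own (branch β n) = P → β n = σ (branch β n)) →
      ParityWon P fun n => pr (branch β n) := by
    intro P X h
    obtain ⟨σ, hσ⟩ := exists_secures_of_mem_winSet hj le_rfl h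
    -- After `j + 1` fixed points the threshold is `0`: no node ends the play, and only the clause
    -- on infinite plays matters, whatever `X` is.
    refine ⟨σ, fun β hβ => (hσ β rfl).2 (fun n _ => hβ n) fun n _ => by omega⟩
  by_cases h : [] ∈ winSet own pr j Player.exist (j + 1) fun _ => ∅
  · exact ⟨_, key _ _ h⟩
  · exact ⟨_, key _ _ ((notMem_winSet_iff own pr j _ _ _ _).1 h)⟩

end Determinacy

/-! ### The two roles, uniformly in the parity of `j` -/

/-- The player who likes the priorities `j - 2` and `j`. -/
def exiter (j : ℕ) : Player := if Even j then Player.exist else Player.univ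

/-- The player who likes the priority `j - 1`. -/
abbrev claimer (j : ℕ) : Player := (exiter j).other

theorem exiter_favours (j : ℕ) : (exiter j).Favours j := by
  unfold exiter
  split_ifs with h <;> exact h

theorem exiter_favours_sub_two {j : ℕ} (hj : 2 ≤ j) : (exiter j).Favours (j - 2) := by
  rw [← Player.favours_add_two, Nat.sub_add_cancel hj]
  exact exiter_favours j

theorem claimer_favours_sub_one {j : ℕ} (hj : 1 ≤ j) : (claimer j).Favours (j - 1) := by
  rw [Player.other_favours, ← Player.favours_succ, Nat.sub_add_cancel hj]
  exact exiter_favours j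

theorem not_claimer_favours (j : ℕ) : ¬ (claimer j).Favours j := by
  rw [Player.other_favours, not_not]
  exact exiter_favours j

namespace EdelLetter

variable (i j : ℕ)

/-- The letter at which the exiter moves. -/
def exitLetter : EdelLetter i j := if Even j then e else a

/-- The letter at which the claimer moves. -/
def claimLetter : EdelLetter i j := if Even j then a else e

@[simp] theorem owner_exitLetter : (exitLetter i j).owner = exiter j := by
  unfold exitLetter exiter
  split_ifs <;> rfl

@[simp] theorem owner_claimLetter : (claimLetter i j).owner = claimer j := by
  unfold claimLetter claimer exiter
  split_ifs <;> rfl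

@[simp] theorem allows_exitLetter (d : Dir) : (exitLetter i j).allows d := by
  unfold exitLetter
  split_ifs <;> trivial

@[simp] theorem allows_claimLetter (d : Dir) : (claimLetter i j).allows d := by
  unfold claimLetter
  split_ifs <;> trivial

@[simp] theorem exitLetter_left : (exitLetter i j).childPriority Dir.L = j - 2 := by
  unfold exitLetter
  split_ifs with h <;> simp [childPriority, h]

@[simp] theorem exitLetter_right : (exitLetter i j).childPriority Dir.R = j - 1 := by
  unfold exitLetter
  split_ifs with h <;> simp [childPriority, h]

@[simp] theorem claimLetter_left : (claimLetter i j).childPriority Dir.L = j - 1 := by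
  unfold claimLetter
  split_ifs with h <;> simp [childPriority, h]

@[simp] theorem claimLetter_right : (claimLetter i j).childPriority Dir.R = j := by
  unfold claimLetter
  split_ifs with h <;> simp [childPriority, h]

end EdelLetter

/-! ### Finite claims and their locality -/

section Forcing

variable (own : Node → Player) (pr : Node → ℕ)

/-- The nodes from which `P` can force the play into `T` within `k` steps. -/
def hitSet (P : Player) (T : List Node) : ℕ → Set Node
  | 0 => {w | w ∈ T}
  | k + 1 => {w | w ∈ T ∨ w ∈ controlSet own P (hitSet P T k)}

/-- The node `w` is a proper descendant of `x`, and the nodes strictly between `x` and `w` have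
priority at least `j - 1`. -/
def ClearPath (j : ℕ) (x w : Node) : Prop :=
  x.length < w.length ∧ x <+: w ∧ ∀ l, x.length < l → l < w.length → j ≤ pr (w.take l) + 1

/-- The pair `(k, T)` is a correct claim below the exit `x` and the frontier `F`: the claimer can
force the play from each node of `F` into `T` in at most `k + 1` steps. -/
def ValidClaim (j : ℕ) (x : Node) (F : List Node) (c : ℕ × List Node) : Prop :=
  (∀ w ∈ c.2, pr w < j ∧ ClearPath pr j x w) ∧
    ∀ v ∈ F, v ∈ controlSet own (claimer j) (hitSet own (claimer j) c.2 c.1)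

variable {own pr} {own' : Node → Player} {pr' : Node → ℕ} {n : ℕ}

theorem mem_controlSet_congr {P : Player} {Y Y' : Set Node} {v : Node} (ho : own' v = own v)
    (hY : ∀ d, v ++ [d] ∈ Y' ↔ v ++ [d] ∈ Y) :
    v ∈ controlSet own' P Y' ↔ v ∈ controlSet own P Y := by
  simp only [controlSet, Set.mem_ofPred_eq, ho, hY]

theorem mem_hitSet_congr (ho : ∀ v : Node, v.length ≤ n → own' v = own v) {P : Player}
    {T : List Node} {k : ℕ} {w : Node} (hw : w.length + k ≤ n) :
    w ∈ hitSet own' P T k ↔ w ∈ hitSet own P T k := by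
  induction k generalizing w with
  | zero => rfl
  | succ k ih =>
    refine or_congr Iff.rfl (mem_controlSet_congr (ho w (by omega)) fun d => ih ?_)
    simp only [List.length_append, List.length_singleton]
    omega

theorem clearPath_congr (hp : ∀ v : Node, v.length ≤ n → pr' v = pr v) {j : ℕ} {x w : Node}
    (hw : w.length ≤ n) : ClearPath pr' j x w ↔ ClearPath pr j x w := by
  refine and_congr Iff.rfl (and_congr Iff.rfl (forall_congr' fun l => ?_))
  rw [hp (w.take l) (by rw [List.length_take]; omega)]

theorem exists_length_le (T : List Node) : ∃ n, ∀ w ∈ T, w.length ≤ n := by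
  induction T with
  | nil => exact ⟨0, by simp⟩
  | cons a T ih =>
    obtain ⟨n, hn⟩ := ih
    refine ⟨max n a.length, fun w hw => ?_⟩
    rcases List.mem_cons.1 hw with rfl | hw
    · exact le_max_right _ _
    · exact (hn w hw).trans (le_max_left _ _)

/-- The step bound and the finiteness of the target confine a claim to nodes of bounded depth.
Continuity of the encoding rests on this. -/
theorem validClaim_congr {m : ℕ} (ho : ∀ v : Node, v.length ≤ n → own' v = own v)
    (hp : ∀ v : Node, v.length ≤ n → pr' v = pr v) {j : ℕ} {x : Node} {F : List Node}
    {c : ℕ × List Node} (hF : ∀ w ∈ F, w.length ≤ m) (hT : ∀ w ∈ c.2, w.length ≤ n)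
    (hm : m + 1 + c.1 ≤ n) : ValidClaim own' pr' j x F c ↔ ValidClaim own pr j x F c := by
  refine and_congr (forall₂_congr fun w hw => ?_) (forall₂_congr fun v hv => ?_)
  · rw [hp w (hT w hw), clearPath_congr hp (hT w hw)]
  · have := hF v hv
    refine mem_controlSet_congr (ho v (by omega)) fun d => mem_hitSet_congr ho ?_
    simp only [List.length_append, List.length_singleton]
    omega

end Forcing

/-! ### The claim game and its encoding as a tree -/

/-- Recurrence ensures that a claim is still available however far the counter has advanced. -/
theorem exists_claim_code :
    ∃ c : ℕ → ℕ × List Node, ∀ a N, ∃ n, N ≤ n ∧ c n = a := by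
  obtain ⟨e, he⟩ := exists_surjective_nat (ℕ × List Node)
  refine ⟨fun n => e n.unpair.2, fun a N => ?_⟩
  obtain ⟨m, rfl⟩ := he a
  exact ⟨Nat.pair N m, Nat.left_le_pair N m, by simp⟩

/-- An enumeration of all possible claims, each of which occurs infinitely often. -/
noncomputable def claimCode : ℕ → ℕ × List Node := exists_claim_code.choose

theorem exists_claimCode_eq (a : ℕ × List Node) (N : ℕ) : ∃ n, N ≤ n ∧ claimCode n = a :=
  exists_claim_code.choose_spec a N

/-- The stages of the game in which the claimer describes, piece by piece, a strategy in the
original game, and the exiter may interrupt at nodes of priority at most `j - 2`. -/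
inductive Stage
  /-- The exiter has won. -/
  | won
  /-- The exiter has lost. -/
  | lost
  /-- After the exit `x`, with frontier `F`, the claimer may make the `n`-th claim. -/
  | claim (x : Node) (F : List Node) (n : ℕ)
  /-- The exiter may choose one of the nodes `ys`; otherwise `F` is the next frontier. -/
  | offer (x : Node) (ys F : List Node)
  /-- The exiter has chosen the node `x`. -/
  | leave (x : Node)

namespace Stage

variable {i j : ℕ} (t : TotalTree (GameLetter i j))

/-- The owner of a node in the game of `t`. -/
abbrev own (v : Node) : Player := (t v).1

/-- The priority of a node in the game of `t`. -/
abbrev pr (v : Node) : ℕ := (t v).2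

theorem pr_le (v : Node) : pr t v ≤ j := (t v).2.2.2

open Classical in
/-- The next stage. -/
noncomputable def next : Stage → Dir → Stage
  | won, _ => won
  | lost, _ => lost
  | claim x F n, Dir.L =>
    if ValidClaim (own t) (pr t) j x F (claimCode n) then
      offer x ((claimCode n).2.filter fun w => pr t w + 2 ≤ j)
        ((claimCode n).2.filter fun w => j < pr t w + 2)
    else won
  | claim x F n, Dir.R => claim x F (n + 1)
  | offer x [] F, Dir.L => claim x F 0
  -- A move with no role in the simulation forfeits: here one of the claimer, in the last case one
  -- of the exiter.
  | offer _ [] _, Dir.R => won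
  | offer _ (y :: _) _, Dir.L => leave y
  | offer x (_ :: ys) F, Dir.R => offer x ys F
  | leave x, Dir.L => claim x [x] 0
  | leave _, Dir.R => lost

/-- The letter that encodes a stage. -/
def letter : Stage → EdelLetter i j
  | won => EdelLetter.exitLetter i j
  | lost => EdelLetter.claimLetter i j
  | claim _ _ _ => EdelLetter.claimLetter i j
  | offer _ [] _ => EdelLetter.claimLetter i j
  | offer _ (_ :: _) _ => EdelLetter.exitLetter i j
  | leave x =>
    -- Priority `j - 2` has no letter of its own; the left child of the exiter's letter carries it.
    if h : pr t x + 3 ≤ j then EdelLetter.num (pr t x) (t x).2.2.1 h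
    else EdelLetter.exitLetter i j

/-- The stage reached after a sequence of moves. -/
noncomputable def after (v : Node) : Stage := v.foldl (next t) (claim [] [[]] 0)

/-- The tree over the edelweiss alphabet that encodes the stages. -/
noncomputable def encode : TotalTree (EdelLetter i j) := fun v => letter t (after t v)

theorem after_concat (v : Node) (d : Dir) : after t (v ++ [d]) = next t (after t v) d := by
  simp [after]

/-! ### Continuity of the encoding -/

section Continuity

open Topology

theorem eventually_agree {A : Type*} (t : TotalTree A) (n : ℕ) :
    ∀ᶠ t' in 𝓝 t, ∀ v : Node, v.length ≤ n → t' v = t v := by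
  have h : ∀ v : Node, ∀ᶠ t' in 𝓝 t, t' v = t v := fun v =>
    IsOpen.mem_nhds (s := {t' : TotalTree A | t' v = t v})
      (TopologicalSpace.isOpen_generateFrom_of_mem ⟨v, t v, rfl⟩) rfl
  exact (eventually_all_finite (List.finite_length_le Dir n)).2 fun v _ => h v

theorem eventually_next_eq (s : Stage) (d : Dir) : ∀ᶠ t' in 𝓝 t, next t' s d = next t s d := by
  match s, d with
  | claim x F n, Dir.L =>
    obtain ⟨a, ha⟩ := exists_length_le F
    obtain ⟨b, hb⟩ := exists_length_le (claimCode n).2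
    filter_upwards [eventually_agree t (a + 1 + (claimCode n).1 + b)] with t' ht
    have hT : ∀ w ∈ (claimCode n).2, t' w = t w := fun w hw =>
      ht w ((hb w hw).trans (by omega))
    have hv : ValidClaim (own t') (pr t') j x F (claimCode n) ↔
        ValidClaim (own t) (pr t) j x F (claimCode n) :=
      validClaim_congr (fun v hv => by rw [own, ht v hv]) (fun v hv => by rw [pr, ht v hv]) ha
        (fun w hw => (hb w hw).trans (by omega)) (Nat.le_add_right _ b)
    have h₁ : ((claimCode n).2.filter fun w => pr t' w + 2 ≤ j) =
        (claimCode n).2.filter fun w => pr t w + 2 ≤ j :=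
      List.filter_congr fun w hw => by rw [pr, hT w hw]
    have h₂ : ((claimCode n).2.filter fun w => j < pr t' w + 2) =
        (claimCode n).2.filter fun w => j < pr t w + 2 :=
      List.filter_congr fun w hw => by rw [pr, hT w hw]
    simp only [next, h₁, h₂]
    by_cases h : ValidClaim (own t) (pr t) j x F (claimCode n)
    · rw [if_pos h, if_pos (hv.2 h)]
    · rw [if_neg h, if_neg (h ∘ hv.1)]
  | won, _ | lost, _ | claim _ _ _, Dir.R | offer _ [] _, Dir.L | offer _ [] _, Dir.R
  | offer _ (_ :: _) _, Dir.L | offer _ (_ :: _) _, Dir.R | leave _, Dir.L | leave _, Dir.R =>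
    exact Eventually.of_forall fun _ => rfl

theorem eventually_letter_eq (s : Stage) : ∀ᶠ t' in 𝓝 t, letter t' s = letter t s := by
  match s with
  | leave x =>
    filter_upwards [eventually_agree t x.length] with t' ht
    have h : pr t' x = pr t x := by rw [pr, ht x le_rfl]
    simp only [letter, h]
  | won | lost | claim _ _ _ | offer _ [] _ | offer _ (_ :: _) _ =>
    exact Eventually.of_forall fun _ => rfl

theorem eventually_after_eq (v : Node) : ∀ᶠ t' in 𝓝 t, after t' v = after t v := by
  induction v using List.reverseRecOn with
  | nil => exact Eventually.of_forall fun _ => rfl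
  | append_singleton v d ih =>
    filter_upwards [ih, eventually_next_eq t (after t v) d] with t' h₁ h₂
    rw [after_concat, after_concat, h₁, h₂]

theorem continuous_encode :
    Continuous (encode : TotalTree (GameLetter i j) → TotalTree (EdelLetter i j)) := by
  refine continuous_generateFrom_iff.2 ?_
  rintro _ ⟨v, b, rfl⟩
  refine isOpen_iff_eventually.2 fun t ht => ?_
  filter_upwards [eventually_after_eq t v, eventually_letter_eq t (after t v)] with t' h₁ h₂
  change letter t' (after t' v) = b
  rw [h₁, h₂]
  exact ht

end Continuity

/-- A sequence of stages, with the moves that are made. -/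
structure Run (s : ℕ → Stage) (d : ℕ → Dir) : Prop where
  zero : s 0 = claim [] [[]] 0
  succ : ∀ n, s (n + 1) = next t (s n) (d n)
  allowed : ∀ n, (letter t (s n)).allows (d n)

/-- Strategies that see only the current stage suffice. Edelweiss priorities sit on the children, so
the priorities of a run are those of the play shifted by one step. -/
theorem wonBy_encode {P : Player} {χ : Stage → Dir} (hχ : ∀ s, (letter t s).allows (χ s))
    (h : ∀ s d, Run t s d → (∀ n, (letter t (s n)).owner = P → d n = χ (s n)) →
      ParityWon P fun n => (letter t (s n)).childPriority (d n)) :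
    (edelGame (encode t)).WonBy P := by
  refine ⟨fun v => v ++ [χ (after t v)], fun v _ => ⟨_, hχ _, rfl⟩, fun π hπ hc => ?_⟩
  choose d hd hπd using hπ.2
  refine parityWon_succ ?_
  have hrun : Run t (fun n => after t (π n)) d :=
    ⟨by rw [hπ.1]; rfl, fun n => by rw [hπd, after_concat], hd⟩
  have := h _ _ hrun fun n hn => by
    have := hc n hn
    rw [hπd] at this
    simpa using this
  convert this using 2 with n
  change edelPriority (encode t) (π (n + 1)) = _
  rw [hπd, edelPriority]
  simp [encode]

end Stage

/-! ### Nodes consistent with a strategy -/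

/-- The node `u` is reached by plays in which `P` follows `σ`. -/
def Consistent (own : Node → Player) (P : Player) (σ : Node → Dir) (u : Node) : Prop :=
  ∀ p d, p ++ [d] <+: u → own p = P → d = σ p

section Consistent

variable {own : Node → Player} {P : Player} {σ : Node → Dir}

theorem consistent_nil : Consistent own P σ [] := fun p d h => by simp at h

theorem consistent_concat {u : Node} {d : Dir} :
    Consistent own P σ (u ++ [d]) ↔ Consistent own P σ u ∧ (own u = P → d = σ u) := by
  constructor
  · exact fun h => ⟨fun p d' hp => h p d' (hp.trans (List.prefix_append _ _)),
      h u d List.prefix_rfl⟩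
  · rintro ⟨h₁, h₂⟩ p d' hp
    rcases List.prefix_concat_iff.1 hp with h | h
    · obtain ⟨rfl, h⟩ := List.append_inj' h rfl
      obtain rfl : d' = d := by simpa using h
      exact h₂
    · exact h₁ p d' h

theorem Consistent.eq_of_branch {β : ℕ → Dir}
    (h : ∀ N, ∃ u, Consistent own P σ u ∧ N ≤ u.length ∧ branch β u.length = u) (n : ℕ)
    (ho : own (branch β n) = P) : β n = σ (branch β n) := by
  obtain ⟨u, hu, hn, hβ⟩ := h (n + 1)
  refine hu (branch β n) (β n) ?_ ho
  change branch β (n + 1) <+: u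
  rw [← hβ, ← take_branch β hn]
  exact List.take_prefix _ _

end Consistent

theorem exists_branch_of_prefix {b : ℕ → Node} (hb : ∀ n, b n <+: b (n + 1))
    (hlen : ∀ N, ∃ n, N ≤ (b n).length) : ∃ β, ∀ n, branch β (b n).length = b n := by
  have hmono : ∀ m n, m ≤ n → b m <+: b n := fun m n h => by
    induction n, h using Nat.le_induction with
    | base => exact List.prefix_rfl
    | succ n _ ih => exact ih.trans (hb n)
  have hpre : ∀ m n l (h : l < (b m).length) (h' : l < (b n).length), (b m)[l] = (b n)[l] := by
    intro m n l h h'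
    rcases le_total m n with hmn | hmn
    · exact (hmono m n hmn).getElem h
    · exact ((hmono n m hmn).getElem h').symm
  choose f hf using fun l => hlen (l + 1)
  have key : ∀ n l, l ≤ (b n).length →
      branch (fun l => (b (f l))[l]'(hf l)) l = (b n).take l := by
    intro n l
    induction l with
    | zero => intro _; simp [branch]
    | succ l ih =>
      intro h
      rw [branch, ih (by omega), hpre _ n l (hf l) (by omega), List.take_append_getElem]
  exact ⟨_, fun n => (key n _ le_rfl).trans (List.take_length)⟩

/-! ### Runs with infinitely many exits -/

namespace Stage

variable {i j : ℕ} {t : TotalTree (GameLetter i j)}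

/-- Claims and offers concern paths without exits. -/
def Sound (t : TotalTree (GameLetter i j)) : Stage → Prop
  | won => True
  | lost => True
  | claim x F _ => ∀ u ∈ F, u = x ∨ ClearPath (pr t) j x u ∧ pr t u + 1 = j
  | offer x ys F => (∀ y ∈ ys, ClearPath (pr t) j x y ∧ pr t y + 2 ≤ j) ∧
      ∀ u ∈ F, ClearPath (pr t) j x u ∧ pr t u + 1 = j
  | leave x => pr t x + 2 ≤ j

theorem next_claim_of_valid {x : Node} {F : List Node} {n : ℕ}
    (h : ValidClaim (own t) (pr t) j x F (claimCode n)) :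
    next t (claim x F n) Dir.L = offer x ((claimCode n).2.filter fun w => pr t w + 2 ≤ j)
        ((claimCode n).2.filter fun w => j < pr t w + 2) := if_pos h

theorem next_claim_of_not_valid {x : Node} {F : List Node} {n : ℕ}
    (h : ¬ ValidClaim (own t) (pr t) j x F (claimCode n)) :
    next t (claim x F n) Dir.L = won := if_neg h

theorem Sound.next {s : Stage} (hs : Sound t s) (d : Dir) : Sound t (next t s d) := by
  match s, d with
  | won, _ | lost, _ => trivial
  | claim x F n, Dir.L =>
    by_cases h : ValidClaim (own t) (pr t) j x F (claimCode n)
    · rw [next_claim_of_valid h]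
      refine ⟨fun y hy => ?_, fun u hu => ?_⟩
      · rw [List.mem_filter, decide_eq_true_iff] at hy
        exact ⟨(h.1 y hy.1).2, hy.2⟩
      · rw [List.mem_filter, decide_eq_true_iff] at hu
        have := h.1 u hu.1
        exact ⟨this.2, by omega⟩
    · rw [next_claim_of_not_valid h]
      trivial
  | claim x F n, Dir.R => exact hs
  | offer x [] F, Dir.L => exact fun u hu => Or.inr (hs.2 u hu)
  | offer _ [] _, Dir.R => trivial
  | offer _ (y :: _) _, Dir.L => exact (hs.1 y List.mem_cons_self).2
  | offer x (_ :: ys) F, Dir.R =>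
    exact ⟨fun y hy => hs.1 y (List.mem_cons_of_mem _ hy), hs.2⟩
  | leave x, Dir.L => exact fun u hu => Or.inl (List.mem_singleton.1 hu)
  | leave _, Dir.R => trivial

/-- The last exit. -/
def base : Stage → Node
  | won => []
  | lost => []
  | claim x _ _ => x
  | offer x _ _ => x
  | leave x => x

/-- The last exit changes only when a new one is chosen, and then to a proper descendant reached by
a clear path. Hence the exits of a run form a chain in the original tree. -/
theorem base_next {s : Stage} (hs : Sound t s) (d : Dir) (h₁ : next t s d ≠ won)
    (h₂ : next t s d ≠ lost) :
    base (next t s d) = base s ∨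
      next t s d = leave (base (next t s d)) ∧
        ClearPath (pr t) j (base s) (base (next t s d)) := by
  match s, d with
  | won, _ | lost, _ => exact Or.inl rfl
  | claim x F n, Dir.L =>
    by_cases h : ValidClaim (own t) (pr t) j x F (claimCode n)
    · rw [next_claim_of_valid h]
      exact Or.inl rfl
    · exact absurd (next_claim_of_not_valid h) h₁
  | claim x F n, Dir.R => exact Or.inl rfl
  | offer x [] F, Dir.L => exact Or.inl rfl
  | offer _ [] _, Dir.R => exact absurd rfl h₁
  | offer _ (y :: _) _, Dir.L => exact Or.inr ⟨rfl, (hs.1 y List.mem_cons_self).1⟩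
  | offer x (_ :: ys) F, Dir.R => exact Or.inl rfl
  | leave x, Dir.L => exact Or.inl rfl
  | leave _, Dir.R => exact absurd rfl h₂

namespace Run

variable {s : ℕ → Stage} {d : ℕ → Dir}

theorem sound (hr : Run t s d) (n : ℕ) : Sound t (s n) := by
  induction n with
  | zero => rw [hr.zero]; exact fun u hu => Or.inl (List.mem_singleton.1 hu)
  | succ n ih => rw [hr.succ]; exact ih.next _

theorem eq_won (hr : Run t s d) {n m : ℕ} (hn : s n = won) (h : n ≤ m) : s m = won := by
  induction m, h using Nat.le_induction with
  | base => exact hn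
  | succ m _ ih => rw [hr.succ, ih]; rfl

theorem eq_lost (hr : Run t s d) {n m : ℕ} (hn : s n = lost) (h : n ≤ m) : s m = lost := by
  induction m, h using Nat.le_induction with
  | base => exact hn
  | succ m _ ih => rw [hr.succ, ih]; rfl

theorem ne_won_of_frequently (hr : Run t s d) (h : ∃ᶠ n in atTop, ∃ x, s n = leave x) (n : ℕ) :
    s n ≠ won := by
  intro hn
  obtain ⟨m, hm, x, hx⟩ := frequently_atTop.1 h n
  rw [hr.eq_won hn hm] at hx
  cases hx

theorem ne_lost_of_frequently (hr : Run t s d) (h : ∃ᶠ n in atTop, ∃ x, s n = leave x) (n : ℕ) :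
    s n ≠ lost := by
  intro hn
  obtain ⟨m, hm, x, hx⟩ := frequently_atTop.1 h n
  rw [hr.eq_lost hn hm] at hx
  cases hx

/-- If there are infinitely many exits, then the winner is determined by their priorities. -/
theorem parityWon_of_frequently (hr : Run t s d) {P : Player} {σ : Node → Dir}
    (hσ : ∀ β, (∀ n, own t (branch β n) = P → β n = σ (branch β n)) →
      ParityWon P fun n => pr t (branch β n))
    (hinf : ∃ᶠ n in atTop, ∃ x, s n = leave x)
    (hcons : ∀ n x, s n = leave x → Consistent (own t) P σ x) :
    ParityWon P fun n => (letter t (s n)).childPriority (d n) := by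
  have hstep : ∀ n, base (s (n + 1)) = base (s n) ∨
      s (n + 1) = leave (base (s (n + 1))) ∧
        ClearPath (pr t) j (base (s n)) (base (s (n + 1))) := fun n => by
    have h₁ := hr.ne_won_of_frequently hinf (n + 1)
    have h₂ := hr.ne_lost_of_frequently hinf (n + 1)
    rw [hr.succ] at h₁ h₂ ⊢
    exact base_next (hr.sound n) _ h₁ h₂
  have hpre : ∀ n, base (s n) <+: base (s (n + 1)) := fun n => by
    rcases hstep n with h | h
    · rw [h]
    · exact h.2.2.1
  have hmono : ∀ {m n}, m ≤ n → (base (s m)).length ≤ (base (s n)).length := fun h =>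
    monotone_nat_of_le_succ (f := fun n => (base (s n)).length) (fun n => (hpre n).length_le) h
  -- Each new exit is strictly deeper than the previous one, so infinitely many exits reach every
  -- depth.
  have hlen : ∀ N M, ∃ n, M ≤ n ∧ N ≤ (base (s n)).length ∧ ∃ x, s n = leave x := by
    intro N M
    induction N with
    | zero =>
      obtain ⟨n, hn, hx⟩ := frequently_atTop.1 hinf M
      exact ⟨n, hn, Nat.zero_le _, hx⟩
    | succ N ih =>
      obtain ⟨m, hm, hN, y, hy⟩ := ih
      obtain ⟨n, hn, hx⟩ := frequently_atTop.1 hinf (m + 2)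
      by_contra! hcon
      have hle : (base (s n)).length ≤ N := by
        by_contra! hlt
        obtain ⟨x, hx⟩ := hx
        exact hcon n (by omega) hlt x hx
      have hconst : ∀ l, m ≤ l → l ≤ n → (base (s l)).length = N := fun l h₁ h₂ => by
        have h₃ := hmono h₁
        have h₄ := hmono h₂
        omega
      obtain ⟨x, hx⟩ := hx
      have hs := hstep (n - 1)
      rw [Nat.sub_add_cancel (by omega)] at hs
      rcases hs with h | h
      · have h₁ := hr.succ (n - 1)
        have hs := hr.sound (n - 1)
        rw [Nat.sub_add_cancel (by omega), hx] at h₁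
        rw [hx] at h
        cases hsn : s (n - 1) with
        | won => exact hr.ne_won_of_frequently hinf _ hsn
        | lost => exact hr.ne_lost_of_frequently hinf _ hsn
        | claim x' F k =>
          rw [hsn] at h₁
          cases hd : d (n - 1) with
          | L =>
            rw [hd] at h₁
            by_cases hv : ValidClaim (own t) (pr t) j x' F (claimCode k)
            · rw [next_claim_of_valid hv] at h₁; cases h₁
            · rw [next_claim_of_not_valid hv] at h₁; cases h₁
          | R => rw [hd] at h₁; cases h₁
        | offer x' ys F =>
          rw [hsn] at h₁ h hs
          cases ys with
          | nil => cases hd : d (n - 1) <;> rw [hd] at h₁ <;> cases h₁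
          | cons y ys =>
            cases hd : d (n - 1) with
            | L =>
              rw [hd] at h₁
              cases h₁
              have := (hs.1 x List.mem_cons_self).1.1
              change x = x' at h
              rw [h] at this
              omega
            | R => rw [hd] at h₁; cases h₁
        | leave x' =>
          rw [hsn] at h₁
          cases hd : d (n - 1) <;> rw [hd] at h₁ <;> cases h₁
      · have h₁ := hconst (n - 1) (by omega) (by omega)
        have h₂ := hconst n (by omega) le_rfl
        have := h.2.1
        omega
  obtain ⟨β, hβ⟩ := exists_branch_of_prefix hpre fun N => by
    obtain ⟨n, -, hn, -⟩ := hlen N 0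
    exact ⟨n, hn⟩
  have hwon := hσ β <| Consistent.eq_of_branch fun N => by
    obtain ⟨n, -, hn, x, hx⟩ := hlen N 0
    have := hβ n
    rw [hx] at hn this
    exact ⟨x, hcons n x hx, hn, this⟩
  have hleave : ∀ n x, s n = leave x →
      (letter t (s n)).childPriority (d n) = pr t x ∧ pr t x + 2 ≤ j := by
    intro n x hx
    have hs := hr.sound n
    rw [hx] at hs
    change pr t x + 2 ≤ j at hs
    have hd : d n = Dir.L := by
      cases hd : d n with
      | L => rfl
      | R =>
        refine absurd ?_ (hr.ne_lost_of_frequently hinf (n + 1))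
        rw [hr.succ, hx, hd]
        rfl
    refine ⟨?_, hs⟩
    rw [hx, hd]
    by_cases h : pr t x + 3 ≤ j
    · simp only [letter, dif_pos h]
      rfl
    · simp only [letter, dif_neg h, EdelLetter.exitLetter_left]
      omega
  -- A node of `β` that is skipped lies strictly between two successive bases, where a clear path
  -- allows only priorities at least `j - 1`. The root is excluded because it is the initial base
  -- without having been chosen as an exit.
  have hexit : ∀ m, 0 < m → pr t (branch β m) + 2 ≤ j → ∃ n, s n = leave (branch β m) := by
    intro m hm hp
    have hex : ∃ n, m ≤ (base (s n)).length := by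
      obtain ⟨n, -, hn, -⟩ := hlen m 0
      exact ⟨n, hn⟩
    classical
    have hspec := Nat.find_spec hex
    have hmin := fun n (h : n < Nat.find hex) => Nat.find_min hex h
    generalize Nat.find hex = n at hspec hmin
    cases n with
    | zero =>
      rw [hr.zero] at hspec
      change m ≤ 0 at hspec
      omega
    | succ n =>
      have hlt := hmin n (by omega)
      rcases hstep n with h | ⟨h, -, -, hclear⟩
      · rw [h] at hspec
        exact absurd hspec hlt
      · rcases hspec.eq_or_lt with heq | hlt'
        · refine ⟨n + 1, ?_⟩
          rw [heq, hβ]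
          exact h
        · have := hclear m (by omega) hlt'
          rw [← hβ (n + 1), take_branch β hlt'.le] at this
          omega
  obtain ⟨m, hPm, hfr, hev⟩ := hwon
  beta_reduce at hfr hev
  obtain ⟨N, hN⟩ := eventually_atTop.1 hev
  -- Exits, whose priorities are at most `j - 2`, occur arbitrarily deep on `β` and so bound `m`.
  have hmj : m + 2 ≤ j := by
    obtain ⟨n, -, hn, x, hx⟩ := hlen N 0
    have h₁ := hN _ hn
    have h₂ := (hleave n x hx).2
    rw [hβ, hx] at h₁
    change m ≤ pr t x at h₁
    omega
  refine ⟨m, hPm, frequently_atTop.2 fun M => ?_, ?_⟩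
  · obtain ⟨l, hl, hpl⟩ := frequently_atTop.1 hfr ((base (s M)).length + 1)
    obtain ⟨n, hn⟩ := hexit l (by omega) (by rw [hpl]; exact hmj)
    refine ⟨n, ?_, (hleave n _ hn).1.trans hpl⟩
    by_contra! hlt
    have := hmono hlt.le
    rw [hn] at this
    change (branch β l).length ≤ _ at this
    rw [length_branch] at this
    omega
  · obtain ⟨M, -, hM, -⟩ := hlen N 0
    filter_upwards [eventually_ge_atTop M] with n hn
    by_cases hx : ∃ x, s n = leave x
    · obtain ⟨x, hx⟩ := hx
      rw [(hleave n x hx).1]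
      have h₁ := hmono hn
      have h₂ := hN (base (s n)).length (by omega)
      rw [hβ, hx] at h₂
      exact h₂
    -- All other stages show at least `j - 2`, hence at least `m`, and do not affect the winner.
    · have h₁ := hr.ne_won_of_frequently hinf n
      have h₂ := hr.ne_lost_of_frequently hinf n
      generalize s n = s' at hx h₁ h₂
      match s' with
      | won => exact absurd rfl h₁
      | lost => exact absurd rfl h₂
      | claim x F k => cases d n <;> simp [letter] <;> omega
      | offer x [] F => cases d n <;> simp [letter] <;> omega
      | offer x (y :: ys) F => cases d n <;> simp [letter] <;> omega
      | leave x => exact absurd ⟨x, rfl⟩ hx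

end Run

end Stage

/-! ### Forcing against a strategy, and compactness -/

section Forcing

variable {own : Node → Player} {pr : Node → ℕ} {P : Player} {σ : Node → Dir}

theorem Consistent.exists_of_mem_controlSet {v : Node} {Y : Set Node}
    (hc : Consistent own P.other σ v) (hv : v ∈ controlSet own P Y) :
    ∃ d, Consistent own P.other σ (v ++ [d]) ∧ v ++ [d] ∈ Y := by
  by_cases h : own v = P
  · obtain ⟨d, hd⟩ := hv.1 h
    exact ⟨d, consistent_concat.2 ⟨hc, fun h' => absurd h ((Player.eq_other_iff _ _).1 h')⟩, hd⟩
  · exact ⟨σ v, consistent_concat.2 ⟨hc, fun _ => rfl⟩, hv.2 h _⟩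

theorem Consistent.exists_of_mem_hitSet {v : Node} {T : List Node} {k : ℕ}
    (hc : Consistent own P.other σ v) (hv : v ∈ hitSet own P T k) :
    ∃ w ∈ T, Consistent own P.other σ w ∧ v <+: w := by
  induction k generalizing v with
  | zero => exact ⟨v, hv, hc, List.prefix_rfl⟩
  | succ k ih =>
    rcases hv with hv | hv
    · exact ⟨v, hv, hc, List.prefix_rfl⟩
    · obtain ⟨d, hd, hd'⟩ := hc.exists_of_mem_controlSet hv
      obtain ⟨w, hw, hw', hp⟩ := ih hd hd'
      exact ⟨w, hw, hw', (List.prefix_append _ _).trans hp⟩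

/-- Playing `σ` against the forcing that the claim asserts must end in the target, so a correct
claim never loses the nodes consistent with the exiter's strategy. Forcing starts with a move, which
makes the descendant proper. -/
theorem Consistent.exists_of_validClaim {j : ℕ} {x : Node} {F : List Node} {c : ℕ × List Node}
    (h : ValidClaim own pr j x F c) {v : Node} (hv : v ∈ F)
    (hc : Consistent own (exiter j) σ v) :
    ∃ w ∈ c.2, Consistent own (exiter j) σ w ∧ v <+: w ∧ v.length < w.length := by
  have hE : exiter j = (claimer j).other := by
    rw [Player.eq_other_iff]
    exact fun h => (Player.eq_other_iff _ _).1 rfl h.symm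
  rw [hE] at hc ⊢
  obtain ⟨d, hd, hd'⟩ := hc.exists_of_mem_controlSet (h.2 v hv)
  obtain ⟨w, hw, hw', hp⟩ := hd.exists_of_mem_hitSet hd'
  refine ⟨w, hw, hw', (List.prefix_append _ _).trans hp, ?_⟩
  have := hp.length_le
  simp only [List.length_append, List.length_singleton] at this
  omega

theorem controlSet_mono {Y Y' : Set Node} (h : Y ⊆ Y') :
    controlSet own P Y ⊆ controlSet own P Y' := fun _ hv =>
  ⟨fun ho => (hv.1 ho).imp fun _ hd => h hd, fun ho d => h (hv.2 ho d)⟩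

/-- This allows finitely many forcing statements to be merged, with concatenated targets and the
maximal bound. -/
theorem hitSet_mono {T T' : List Node} (hT : ∀ w ∈ T, w ∈ T') {k k' : ℕ} (hk : k ≤ k') :
    hitSet own P T k ⊆ hitSet own P T' k' := by
  induction k generalizing k' with
  | zero =>
    intro w hw
    cases k' with
    | zero => exact hT w hw
    | succ k' => exact Or.inl (hT w hw)
  | succ k ih =>
    obtain ⟨k', rfl⟩ : ∃ l, k' = l + 1 := ⟨k' - 1, by omega⟩
    exact fun w hw => hw.imp (hT w) (fun h => controlSet_mono (ih (by omega)) h)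

/-- Below `v`, the player `P` who follows `σ` forces the play into nodes of priority less than
`j` within a bounded number of steps. -/
def FiniteHit (own : Node → Player) (pr : Node → ℕ) (P : Player) (σ : Node → Dir) (j : ℕ)
    (v : Node) : Prop :=
  ∃ k T, v ∈ hitSet own P T k ∧ ∀ w ∈ T, Consistent own P σ w ∧ pr w < j ∧ v <+: w ∧
    ∀ l, v.length ≤ l → l < w.length → j ≤ pr (w.take l)

/-- At a node of `P` only the child chosen by `σ` matters; at a node of the opponent the targets of
both children are merged. -/
theorem Consistent.exists_mem_controlSet {j : ℕ} {v : Node} (hv : Consistent own P σ v)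
    (h : ∀ d, Consistent own P σ (v ++ [d]) → FiniteHit own pr P σ j (v ++ [d])) :
    ∃ k T, v ∈ controlSet own P (hitSet own P T k) ∧ ∀ w ∈ T, Consistent own P σ w ∧ pr w < j ∧
      v <+: w ∧ v.length < w.length ∧ ∀ l, v.length < l → l < w.length → j ≤ pr (w.take l) := by
  have hw : ∀ d w, (v ++ [d] <+: w ∧ ∀ l, (v ++ [d]).length ≤ l → l < w.length →
      j ≤ pr (w.take l)) → v <+: w ∧ v.length < w.length ∧
      ∀ l, v.length < l → l < w.length → j ≤ pr (w.take l) := by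
    rintro d w ⟨h₁, h₂⟩
    have := h₁.length_le
    simp only [List.length_append, List.length_singleton] at this h₂
    exact ⟨(List.prefix_append _ _).trans h₁, by omega, fun l hl => h₂ l (by omega)⟩
  by_cases ho : own v = P
  · obtain ⟨k, T, hk, hT⟩ := h (σ v) (consistent_concat.2 ⟨hv, fun _ => rfl⟩)
    exact ⟨k, T, ⟨fun _ => ⟨_, hk⟩, fun h => absurd ho h⟩,
      fun w hwT => ⟨(hT w hwT).1, (hT w hwT).2.1, hw _ w (hT w hwT).2.2⟩⟩
  · have hc : ∀ d, Consistent own P σ (v ++ [d]) := fun d =>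
      consistent_concat.2 ⟨hv, fun h => absurd h ho⟩
    obtain ⟨k, T, hk, hT⟩ := h Dir.L (hc _)
    obtain ⟨k', T', hk', hT'⟩ := h Dir.R (hc _)
    refine ⟨max k k', T ++ T', ⟨fun h => absurd h ho, fun _ d => ?_⟩, fun w hwT => ?_⟩
    · cases d with
      | L => exact hitSet_mono (fun w => List.mem_append_left _) (le_max_left _ _) hk
      | R => exact hitSet_mono (fun w => List.mem_append_right _) (le_max_right _ _) hk'
    · rcases List.mem_append.1 hwT with hwT | hwT
      · exact ⟨(hT w hwT).1, (hT w hwT).2.1, hw _ w (hT w hwT).2.2⟩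
      · exact ⟨(hT' w hwT).1, (hT' w hwT).2.1, hw _ w (hT' w hwT).2.2⟩

/-- König's lemma: a consistent node without a finite hit has priority `j` and a consistent child
without one. The resulting branch conforms to `σ` but eventually shows only `j`, which `P` dislikes.
-/
theorem finiteHit_of_winning {j : ℕ} (hj : ∀ v, pr v ≤ j) (hP : ¬ P.Favours j)
    (hσ : ∀ β, (∀ n, own (branch β n) = P → β n = σ (branch β n)) →
      ParityWon P fun n => pr (branch β n)) {v : Node} (hv : Consistent own P σ v) :
    FiniteHit own pr P σ j v := by
  by_contra hnot
  have hQ : ∀ u, Consistent own P σ u ∧ ¬ FiniteHit own pr P σ j u → ∃ d, j ≤ pr u ∧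
      Consistent own P σ (u ++ [d]) ∧ ¬ FiniteHit own pr P σ j (u ++ [d]) := by
    rintro u ⟨hu, hn⟩
    have hp : j ≤ pr u := by
      by_contra! hlt
      refine hn ⟨0, [u], List.mem_singleton_self u, fun w hw => ?_⟩
      obtain rfl := List.mem_singleton.1 hw
      exact ⟨hu, hlt, List.prefix_rfl, fun l _ _ => by omega⟩
    by_contra! hall
    obtain ⟨k, T, hk, hT⟩ := hu.exists_mem_controlSet fun d hd => hall d hp hd
    refine hn ⟨k + 1, T, Or.inr hk, fun w hw => ?_⟩
    obtain ⟨h₁, h₂, h₃, -, h₄⟩ := hT w hw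
    refine ⟨h₁, h₂, h₃, fun l hl hl' => ?_⟩
    rcases hl.eq_or_lt with rfl | hl
    · rwa [← List.prefix_iff_eq_take.1 h₃]
    · exact h₄ l hl hl'
  choose! g hg using hQ
  let b : ℕ → Node := fun n => (fun u => u ++ [g u])^[n] v
  have hb : ∀ n, b (n + 1) = b n ++ [g (b n)] := fun n => Function.iterate_succ_apply' _ _ _
  have hbQ : ∀ n, Consistent own P σ (b n) ∧ ¬ FiniteHit own pr P σ j (b n) := fun n => by
    induction n with
    | zero => exact ⟨hv, hnot⟩
    | succ n ih => rw [hb]; exact (hg _ ih).2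
  have hlen : ∀ n, (b n).length = v.length + n := fun n => by
    induction n with
    | zero => rfl
    | succ n ih => rw [hb, List.length_append, ih]; rfl
  obtain ⟨β, hβ⟩ := exists_branch_of_prefix (b := b)
    (fun n => by rw [hb]; exact List.prefix_append _ _)
    fun N => ⟨N, by rw [hlen]; omega⟩
  have hwin := hσ β <| Consistent.eq_of_branch fun N =>
    ⟨b N, (hbQ N).1, by rw [hlen]; omega, hβ N⟩
  have hpr : ∀ n, v.length ≤ n → pr (branch β n) = j := fun n hn => by
    have h₁ := hβ (n - v.length)
    rw [hlen, Nat.add_sub_cancel' hn] at h₁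
    rw [h₁]
    exact le_antisymm (hj _) (hg _ (hbQ _)).1
  exact hP (hwin.favours (eventually_atTop.2 ⟨_, hpr⟩).frequently
    (eventually_atTop.2 ⟨_, fun n hn => (hpr n hn).ge⟩))

/-- Finite hits below the frontier nodes are merged. A frontier node other than `x` has priority `j
- 1`, so passing through it keeps the path from `x` clear. -/
theorem exists_validClaim {j : ℕ} (hj : ∀ v, pr v ≤ j)
    (hσ : ∀ β, (∀ n, own (branch β n) = claimer j → β n = σ (branch β n)) →
      ParityWon (claimer j) fun n => pr (branch β n)) {x : Node} {F : List Node}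
    (hF : ∀ v ∈ F, Consistent own (claimer j) σ v ∧
      (v = x ∨ ClearPath pr j x v ∧ pr v + 1 = j)) :
    ∃ c, ValidClaim own pr j x F c ∧ ∀ w ∈ c.2, Consistent own (claimer j) σ w := by
  induction F with
  -- With an empty frontier the empty claim is correct, so the claimer can continue even when
  -- nothing is left to force.
  | nil => exact ⟨(0, []), ⟨by simp, by simp⟩, by simp⟩
  | cons v F ih =>
    obtain ⟨⟨k, T⟩, ⟨hT, hk⟩, hc⟩ := ih fun u hu => hF u (List.mem_cons_of_mem _ hu)
    obtain ⟨hv, hvx⟩ := hF v List.mem_cons_self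
    obtain ⟨k', T', hk', hT'⟩ := hv.exists_mem_controlSet fun d hd =>
      finiteHit_of_winning hj (not_claimer_favours j) hσ hd
    refine ⟨(max k k', T ++ T'), ⟨fun w hw => ?_, fun u hu => ?_⟩, fun w hw => ?_⟩
    · rcases List.mem_append.1 hw with hw | hw
      · exact hT w hw
      · obtain ⟨-, h₁, h₂, h₃, h₄⟩ := hT' w hw
        refine ⟨h₁, ?_⟩
        rcases hvx with rfl | ⟨⟨h₅, h₆, h₇⟩, h₈⟩
        · exact ⟨h₃, h₂, fun l hl hl' => (h₄ l hl hl').trans (Nat.le_succ _)⟩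
        · refine ⟨h₅.trans h₃, h₆.trans h₂, fun l hl hl' => ?_⟩
          rcases lt_trichotomy l v.length with h | rfl | h
          · have := h₇ l hl h
            rwa [List.prefix_iff_eq_take.1 h₂, List.take_take, min_eq_left h.le] at this
          · rw [← List.prefix_iff_eq_take.1 h₂]
            exact h₈.ge
          · exact (h₄ l h hl').trans (Nat.le_succ _)
    · rcases List.mem_cons.1 hu with rfl | hu
      · exact controlSet_mono
          (hitSet_mono (fun w => List.mem_append_right _) (le_max_right _ _)) hk'
      · exact controlSet_mono
          (hitSet_mono (fun w => List.mem_append_left _) (le_max_left _ _)) (hk u hu)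
    · rcases List.mem_append.1 hw with hw | hw
      · exact hc w hw
      · exact (hT' w hw).1

end Forcing

/-! ### Transfer of the exiter's winning strategy -/

namespace Stage

variable {i j : ℕ} {t : TotalTree (GameLetter i j)} {σ : Node → Dir}

theorem Run.exists_left {s : ℕ → Stage} {d : ℕ → Dir} (hr : Run t s d) {n : ℕ} {x : Node}
    {F : List Node} {k : ℕ} (hn : s n = claim x F k) :
    (∃ m, n ≤ m ∧ (∃ k', s m = claim x F k') ∧ d m = Dir.L) ∨
      ∀ m, s (n + m) = claim x F (k + m) ∧ d (n + m) = Dir.R := by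
  by_cases h : ∃ m, n ≤ m ∧ (∃ k', s m = claim x F k') ∧ d m = Dir.L
  · exact Or.inl h
  · refine Or.inr ?_
    have hR : ∀ m k', n ≤ m → s m = claim x F k' → d m = Dir.R := fun m k' hm hs => by
      cases hd : d m with
      | L => exact absurd ⟨m, hm, ⟨k', hs⟩, hd⟩ h
      | R => rfl
    intro m
    induction m with
    | zero => exact ⟨hn, hR _ _ le_rfl hn⟩
    | succ m ih =>
      have : s (n + (m + 1)) = claim x F (k + (m + 1)) := by
        rw [← add_assoc, hr.succ, ih.1, ih.2]
        rfl
      exact ⟨this, hR _ _ (by omega) this⟩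

open Classical in
/-- The exiter takes an exit if it is consistent with the strategy in the original game. -/
noncomputable def exiterMove (t : TotalTree (GameLetter i j)) (σ : Node → Dir) : Stage → Dir
  | offer _ (y :: _) _ => if Consistent (own t) (exiter j) σ y then Dir.L else Dir.R
  | _ => Dir.L

theorem allows_left (s : Stage) : (letter t s).allows Dir.L := by
  cases letter t s <;> trivial

theorem allows_exiterMove (s : Stage) : (letter t s).allows (exiterMove t σ s) := by
  match s with
  | offer _ (y :: _) _ => exact EdelLetter.allows_exitLetter _ _ _
  | won | lost | claim _ _ _ | offer _ [] _ | leave _ => exact allows_left _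

/-- There is a consistent node for the exiter to wait for. -/
def ExiterSafe (t : TotalTree (GameLetter i j)) (σ : Node → Dir) : Stage → Prop
  | won => True
  | lost => False
  | claim _ F _ => ∃ u ∈ F, Consistent (own t) (exiter j) σ u
  | offer _ ys F => ∃ u, (u ∈ ys ∨ u ∈ F) ∧ Consistent (own t) (exiter j) σ u
  | leave x => Consistent (own t) (exiter j) σ x

/-- At a number letter the move is forced; otherwise the node belongs to the exiter, who follows
`χ`. -/
theorem eq_left_of_leave {P : Player} {x : Node} {d : Dir} {χ : Stage → Dir}
    (h : (letter t (leave x)).allows d)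
    (hc : (letter t (leave x)).owner = P → d = χ (leave x))
    (hP : P = exiter j) (hχ : χ (leave x) = Dir.L) : d = Dir.L := by
  by_cases hx : pr t x + 3 ≤ j
  · simp only [letter, dif_pos hx] at h
    cases d with
    | L => rfl
    | R => exact h.elim
  · rw [hc _, hχ]
    simp only [letter, dif_neg hx]
    rw [EdelLetter.owner_exitLetter, hP]

theorem ExiterSafe.next {s : Stage} {d : Dir} (hs : ExiterSafe t σ s)
    (ha : (letter t s).allows d)
    (hc : (letter t s).owner = exiter j → d = exiterMove t σ s) :
    ExiterSafe t σ (next t s d) := by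
  match s, d with
  | won, _ => trivial
  | lost, _ => exact hs
  | claim x F n, Dir.L =>
    by_cases h : ValidClaim (own t) (pr t) j x F (claimCode n)
    · rw [next_claim_of_valid h]
      obtain ⟨u, hu, hc⟩ := hs
      obtain ⟨w, hw, hw', -⟩ := hc.exists_of_validClaim h hu
      refine ⟨w, ?_, hw'⟩
      simp only [List.mem_filter, hw, true_and, decide_eq_true_iff]
      exact le_or_gt _ _
    · rw [next_claim_of_not_valid h]
      trivial
  | claim x F n, Dir.R => exact hs
  | offer x [] F, Dir.L =>
    obtain ⟨u, hu | hu, hc⟩ := hs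
    · simp at hu
    · exact ⟨u, hu, hc⟩
  | offer _ [] _, Dir.R => trivial
  | offer _ (y :: _) _, Dir.L =>
    have := hc (EdelLetter.owner_exitLetter _ _)
    by_contra h
    have h' : ¬ Consistent (own t) (exiter j) σ y := h
    simp only [exiterMove] at this
    rw [if_neg h'] at this
    cases this
  | offer x (y :: ys) F, Dir.R =>
    have := hc (EdelLetter.owner_exitLetter _ _)
    have hy : ¬ Consistent (own t) (exiter j) σ y := fun h => by
      simp only [exiterMove] at this
      rw [if_pos h] at this
      cases this
    obtain ⟨u, hu | hu, hu'⟩ := hs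
    · rcases List.mem_cons.1 hu with rfl | hu
      · exact absurd hu' hy
      · exact ⟨u, Or.inl hu, hu'⟩
    · exact ⟨u, Or.inr hu, hu'⟩
  | leave x, Dir.L => exact ⟨x, List.mem_singleton_self x, hs⟩
  | leave x, Dir.R => cases eq_left_of_leave ha hc rfl rfl

/-- Without further exits every offered node is declined, which the exiter's strategy does only at
inconsistent nodes. The claimer then has to proceed to the new frontier, since the alternative
forfeits. -/
theorem exists_next_frontier {s : ℕ → Stage} {d : ℕ → Dir} (hr : Run t s d)
    (hc : ∀ n, (letter t (s n)).owner = exiter j → d n = exiterMove t σ (s n)) {N : ℕ}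
    (hN : ∀ n, N ≤ n → ¬ ∃ x, s n = leave x) (hwon : ∀ n, s n ≠ won) {x : Node}
    {ys F : List Node} {n : ℕ} (hn : N ≤ n) (hs : s n = offer x ys F) :
    (∃ m, n < m ∧ s m = claim x F 0) ∧ ∀ y ∈ ys, ¬ Consistent (own t) (exiter j) σ y := by
  induction ys generalizing n with
  | nil =>
    have h₁ := hr.succ n
    rw [hs] at h₁
    cases hd : d n with
    | L =>
      rw [hd] at h₁
      exact ⟨⟨n + 1, by omega, h₁⟩, by simp⟩
    | R =>
      rw [hd] at h₁
      exact absurd h₁ (hwon _)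
  | cons y ys ih =>
    have h₁ := hr.succ n
    rw [hs] at h₁
    cases hd : d n with
    | L =>
      rw [hd] at h₁
      exact absurd ⟨y, h₁⟩ (hN (n + 1) (by omega))
    | R =>
      rw [hd] at h₁
      obtain ⟨⟨m, hm, hm'⟩, hy⟩ := ih (n := n + 1) (by omega) h₁
      refine ⟨⟨m, by omega, hm'⟩, fun z hz => ?_⟩
      rcases List.mem_cons.1 hz with rfl | hz
      · intro hz
        have := hc n (by rw [hs]; exact EdelLetter.owner_exitLetter _ _)
        rw [hs, hd] at this
        simp only [exiterMove] at this
        rw [if_pos hz] at this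
        cases this
      · exact hy z hz

/-- A winning strategy of the exiter carries over to the encoding. -/
theorem exiter_wonBy_encode (hj : 2 ≤ j)
    (hσ : ∀ β, (∀ n, own t (branch β n) = exiter j → β n = σ (branch β n)) →
      ParityWon (exiter j) fun n => pr t (branch β n)) :
    (edelGame (encode t)).WonBy (exiter j) := by
  refine wonBy_encode t (χ := exiterMove t σ) allows_exiterMove fun s d hr hc => ?_
  have hsafe : ∀ n, ExiterSafe t σ (s n) := fun n => by
    induction n with
    | zero => rw [hr.zero]; exact ⟨[], List.mem_singleton_self _, consistent_nil⟩
    | succ n ih => rw [hr.succ]; exact ih.next (hr.allowed n) (hc n)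
  by_cases hwon : ∃ n, s n = won
  · obtain ⟨n, hn⟩ := hwon
    have hp : ∀ m, n ≤ m → (letter t (s m)).childPriority (d m) = j - 2 := fun m hm => by
      have h₁ := hr.eq_won hn hm
      have h₂ := hc m (by rw [h₁]; exact EdelLetter.owner_exitLetter _ _)
      rw [h₂, h₁]
      exact EdelLetter.exitLetter_left _ _
    exact ⟨j - 2, exiter_favours_sub_two hj,
      (eventually_atTop.2 ⟨n, hp⟩).frequently,
      eventually_atTop.2 ⟨n, fun m hm => (hp m hm).ge⟩⟩
  push Not at hwon
  by_cases hinf : ∃ᶠ n in atTop, ∃ x, s n = leave x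
  · refine hr.parityWon_of_frequently hσ hinf fun n x hx => ?_
    have := hsafe n
    rwa [hx] at this
  obtain ⟨N, hN⟩ := eventually_atTop.1 (not_frequently.1 hinf)
  by_contra hlose
  -- A claimer who waits forever shows only `j`, and the exiter wins.
  have hleft : ∀ n x F k, s n = claim x F k →
      ∃ m, n ≤ m ∧ (∃ k', s m = claim x F k') ∧ d m = Dir.L := by
    intro n x F k hn
    refine (hr.exists_left hn).resolve_right fun h => hlose ?_
    have hp : ∀ m, n ≤ m → (letter t (s m)).childPriority (d m) = j := fun m hm => by
      have := h (m - n)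
      rw [Nat.add_sub_cancel' hm] at this
      rw [this.1, this.2]
      exact EdelLetter.claimLetter_right _ _
    exact ⟨j, exiter_favours j, (eventually_atTop.2 ⟨n, hp⟩).frequently,
      eventually_atTop.2 ⟨n, fun m hm => (hp m hm).ge⟩⟩
  obtain ⟨x, F₀, k₀, n₀, hn₀, hs₀⟩ : ∃ x F k n, N ≤ n ∧ s n = claim x F k := by
    have h₁ := hwon N
    have h₂ := hsafe N
    have h₃ := hN N le_rfl
    cases hs : s N with
    | won => exact absurd hs h₁
    | lost => rw [hs] at h₂; exact h₂.elim
    | claim x F k => exact ⟨x, F, k, N, le_rfl, hs⟩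
    | offer x ys F =>
      obtain ⟨⟨m, hm, hm'⟩, -⟩ := exists_next_frontier hr hc hN hwon le_rfl hs
      exact ⟨x, F, 0, m, hm.le, hm'⟩
    | leave x => exact absurd ⟨x, hs⟩ h₃
  -- Each consistent frontier node has a consistent proper descendant in a later frontier. Iterating
  -- this produces a branch that conforms to `σ`.
  let Q : Node → Prop := fun u => Consistent (own t) (exiter j) σ u ∧
    ∃ F k n, N ≤ n ∧ s n = claim x F k ∧ u ∈ F
  have hQ : ∀ u, Q u → ∃ u', Q u' ∧ u <+: u' ∧ u.length < u'.length ∧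
      ClearPath (pr t) j x u' ∧ pr t u' + 1 = j := by
    rintro u ⟨hu, F, k, n, hn, hs, hF⟩
    obtain ⟨m, hm, ⟨k', hs'⟩, hd⟩ := hleft n x F k hs
    have h₁ := hr.succ m
    rw [hs', hd] at h₁
    by_cases hv : ValidClaim (own t) (pr t) j x F (claimCode k')
    · rw [next_claim_of_valid hv] at h₁
      obtain ⟨w, hw, hwc, hp, hl⟩ := hu.exists_of_validClaim hv hF
      obtain ⟨⟨m', hm', hs''⟩, hno⟩ := exists_next_frontier hr hc hN hwon (by omega) h₁
      have hw₁ : ¬ pr t w + 2 ≤ j := fun h => hno w (by simp [hw, h]) hwc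
      have hw₂ := hv.1 w hw
      exact ⟨w, ⟨hwc, _, 0, m', by omega, hs'', by simp [hw]; omega⟩, hp, hl, hw₂.2, by omega⟩
    · rw [next_claim_of_not_valid hv] at h₁
      exact absurd h₁ (hwon _)
  obtain ⟨u₀, hu₀⟩ : ∃ u, Q u := by
    have := hsafe n₀
    rw [hs₀] at this
    obtain ⟨u, hu, hu'⟩ := this
    exact ⟨u, hu', F₀, k₀, n₀, hn₀, hs₀, hu⟩
  choose! g hg using hQ
  let b : ℕ → Node := fun n => g^[n] u₀
  have hb : ∀ n, b (n + 1) = g (b n) := fun n => Function.iterate_succ_apply' _ _ _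
  have hbQ : ∀ n, Q (b n) := fun n => by
    induction n with
    | zero => exact hu₀
    | succ n ih => rw [hb]; exact (hg _ ih).1
  have hg' := fun n => hg (b n) (hbQ n)
  simp only [← hb] at hg'
  have hlen : ∀ n, n ≤ (b n).length := fun n => by
    induction n with
    | zero => exact Nat.zero_le _
    | succ n ih => have := (hg' n).2.2.1; omega
  obtain ⟨β, hβ⟩ := exists_branch_of_prefix (fun n => (hg' n).2.1) fun N => ⟨N, hlen N⟩
  have hwin := hσ β <| Consistent.eq_of_branch fun N => ⟨b N, (hbQ N).1, hlen N, hβ N⟩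
  -- On `β` the priority `j - 1` recurs and nothing smaller occurs below `x`, so the winning
  -- strategy `σ` would lose.
  refine claimer_favours_sub_one (j := j) (by omega) |> (Player.other_favours _ _).1 <| ?_
  refine hwin.favours (frequently_atTop.2 fun M => ⟨_, (hlen (M + 1)).trans' (by omega), ?_⟩)
    (eventually_atTop.2 ⟨x.length + 1, fun m hm => ?_⟩)
  · rw [hβ]
    have := (hg' M).2.2.2.2
    omega
  · have h₁ := (hg' m).2.2.2.1.2.2 m (by omega) (by have := hlen (m + 1); omega)
    rw [← hβ (m + 1), take_branch β (by have := hlen (m + 1); omega)] at h₁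
    omega

end Stage

/-! ### Transfer of the claimer's winning strategy -/

namespace Stage

variable {i j : ℕ} {t : TotalTree (GameLetter i j)} {σ : Node → Dir}

open Classical in
/-- The claimer makes only correct claims that are consistent with the strategy in the original
game. -/
noncomputable def claimerMove (t : TotalTree (GameLetter i j)) (σ : Node → Dir) : Stage → Dir
  | claim x F n =>
    if ValidClaim (own t) (pr t) j x F (claimCode n) ∧
      ∀ w ∈ (claimCode n).2, Consistent (own t) (claimer j) σ w then Dir.L else Dir.R
  | _ => Dir.L

theorem allows_claimerMove (s : Stage) : (letter t s).allows (claimerMove t σ s) := by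
  match s with
  | claim _ _ _ => exact EdelLetter.allows_claimLetter _ _ _
  | won | lost | offer _ _ _ | leave _ => exact allows_left _

/-- All nodes in play are consistent with the strategy of the claimer. -/
def ClaimerSafe (t : TotalTree (GameLetter i j)) (σ : Node → Dir) : Stage → Prop
  | won => False
  | lost => True
  | claim _ F _ => ∀ u ∈ F, Consistent (own t) (claimer j) σ u
  | offer _ ys F => ∀ u, (u ∈ ys ∨ u ∈ F) → Consistent (own t) (claimer j) σ u
  | leave x => Consistent (own t) (claimer j) σ x

theorem ClaimerSafe.next {s : Stage} {d : Dir} (hs : ClaimerSafe t σ s)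
    (hc : (letter t s).owner = claimer j → d = claimerMove t σ s) :
    ClaimerSafe t σ (next t s d) := by
  match s, d with
  | won, _ => exact hs
  | lost, _ => trivial
  | claim x F n, Dir.L =>
    have := hc (EdelLetter.owner_claimLetter _ _)
    have h : ValidClaim (own t) (pr t) j x F (claimCode n) ∧
        ∀ w ∈ (claimCode n).2, Consistent (own t) (claimer j) σ w := by
      by_contra h
      simp only [claimerMove] at this
      rw [if_neg h] at this
      cases this
    rw [next_claim_of_valid h.1]
    rintro u (hu | hu) <;> exact h.2 u (List.mem_filter.1 hu).1
  | claim x F n, Dir.R => exact hs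
  | offer x [] F, Dir.L => exact fun u hu => hs u (Or.inr hu)
  | offer _ [] _, Dir.R => cases hc (EdelLetter.owner_claimLetter _ _)
  | offer _ (y :: _) _, Dir.L => exact hs y (Or.inl List.mem_cons_self)
  | offer x (y :: ys) F, Dir.R =>
    exact fun u hu => hs u (hu.imp_left (List.mem_cons_of_mem _))
  | leave x, Dir.L =>
    intro u hu
    obtain rfl := List.mem_singleton.1 hu
    exact hs
  | leave x, Dir.R => trivial

/-- A winning strategy of the claimer carries over to the encoding. -/
theorem claimer_wonBy_encode (hj : 2 ≤ j)
    (hσ : ∀ β, (∀ n, own t (branch β n) = claimer j → β n = σ (branch β n)) →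
      ParityWon (claimer j) fun n => pr t (branch β n)) :
    (edelGame (encode t)).WonBy (claimer j) := by
  refine wonBy_encode t (χ := claimerMove t σ) allows_claimerMove fun s d hr hc => ?_
  have hsafe : ∀ n, ClaimerSafe t σ (s n) := fun n => by
    induction n with
    | zero =>
      rw [hr.zero]
      intro u hu
      obtain rfl := List.mem_singleton.1 hu
      exact consistent_nil
    | succ n ih => rw [hr.succ]; exact ih.next (hc n)
  have hfav := claimer_favours_sub_one (j := j) (by omega)
  by_cases hlost : ∃ n, s n = lost
  · obtain ⟨n, hn⟩ := hlost
    have hp : ∀ m, n ≤ m → (letter t (s m)).childPriority (d m) = j - 1 := fun m hm => by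
      have h₁ := hr.eq_lost hn hm
      have h₂ := hc m (by rw [h₁]; exact EdelLetter.owner_claimLetter _ _)
      rw [h₂, h₁]
      exact EdelLetter.claimLetter_left _ _
    exact ⟨j - 1, hfav, (eventually_atTop.2 ⟨n, hp⟩).frequently,
      eventually_atTop.2 ⟨n, fun m hm => (hp m hm).ge⟩⟩
  push Not at hlost
  by_cases hinf : ∃ᶠ n in atTop, ∃ x, s n = leave x
  · refine hr.parityWon_of_frequently hσ hinf fun n x hx => ?_
    have := hsafe n
    rwa [hx] at this
  obtain ⟨N, hN⟩ := eventually_atTop.1 (not_frequently.1 hinf)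
  -- After the last exit every offer is declined, so all moves outside claim stages show `j - 1`.
  have hcases : ∀ n, N ≤ n → (∃ x F k, s n = claim x F k) ∨
      (letter t (s n)).childPriority (d n) = j - 1 := by
    intro n hn
    have h₁ := hlost n
    have h₂ := hsafe n
    have h₃ := hN n hn
    have h₄ := hN (n + 1) (by omega)
    have h₅ := hc n
    rw [hr.succ] at h₄
    generalize s n = s' at h₁ h₂ h₃ h₄ h₅ ⊢
    match s' with
    | won => exact h₂.elim
    | lost => exact absurd rfl h₁
    | claim x F k => exact Or.inl ⟨x, F, k, rfl⟩
    | offer x [] F =>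
      right
      rw [h₅ (EdelLetter.owner_claimLetter _ _)]
      exact EdelLetter.claimLetter_left _ _
    | offer x (y :: ys) F =>
      right
      cases hd : d n with
      | L => rw [hd] at h₄; exact absurd ⟨y, rfl⟩ h₄
      | R => exact EdelLetter.exitLetter_right _ _
    | leave x => exact absurd ⟨x, rfl⟩ h₃
  refine ⟨j - 1, hfav, frequently_atTop.2 fun M => ?_, eventually_atTop.2 ⟨N, fun n hn => ?_⟩⟩
  · rcases hcases (max M N) (le_max_right _ _) with ⟨x, F, k, hs⟩ | h
    · rcases hr.exists_left hs with ⟨m, hm, ⟨k', hs'⟩, hd⟩ | h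
      · refine ⟨m, (le_max_left _ _).trans hm, ?_⟩
        simp only [hs', hd]
        exact EdelLetter.claimLetter_left _ _
      · have hF : ∀ v ∈ F, Consistent (own t) (claimer j) σ v ∧
            (v = x ∨ ClearPath (pr t) j x v ∧ pr t v + 1 = j) := fun v hv => by
          have h₁ := hsafe (max M N)
          have h₂ := hr.sound (max M N)
          rw [hs] at h₁ h₂
          exact ⟨h₁ v hv, h₂ v hv⟩
        -- A correct claim consistent with `σ` exists and recurs beyond the current counter; the
        -- claimer's strategy would make it instead of waiting forever.
        obtain ⟨c, hv, hcon⟩ := exists_validClaim (pr_le t) hσ hF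
        obtain ⟨k', hk', rfl⟩ := exists_claimCode_eq c k
        have h₁ := h (k' - k)
        rw [Nat.add_sub_cancel' hk'] at h₁
        have h₂ := hc _ (by rw [h₁.1]; exact EdelLetter.owner_claimLetter _ _)
        rw [h₁.1, h₁.2] at h₂
        simp only [claimerMove] at h₂
        rw [if_pos ⟨hv, hcon⟩] at h₂
        cases h₂
    · exact ⟨_, le_max_left _ _, h⟩
  · rcases hcases n hn with ⟨x, F, k, hs⟩ | h
    · simp only [hs]
      cases d n <;> simp [letter]
    · exact h.ge

/-! ### The reduction -/

/-- By determinacy one of the two transfers always applies. As no game is won by both players, a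
common winner is enough for the equivalence. -/
theorem exists_wonBy_encode (hj : 2 ≤ j) (t : TotalTree (GameLetter i j)) :
    ∃ P, (treeGame t).WonBy P ∧ (edelGame (encode t)).WonBy P := by
  obtain ⟨P, σ, hσ⟩ := parity_determined (own := own t) (pr_le t)
  refine ⟨P, ⟨fun v => v ++ [σ v], fun v _ => ⟨σ v, rfl⟩, fun π hπ hc => ?_⟩, ?_⟩
  · obtain ⟨β, hβ⟩ := exists_branch hπ.1 hπ.2
    obtain rfl : π = branch β := funext hβ
    exact hσ β fun n hn => by simpa [branch] using hc n hn
  · by_cases hP : P = exiter j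
    · subst hP
      exact exiter_wonBy_encode hj hσ
    · obtain rfl := (Player.eq_other_iff _ _).2 hP
      exact claimer_wonBy_encode hj hσ

end Stage

theorem mainTheorem8 (i j : ℕ) (hij : i + 2 ≤ j) :
    ContinuouslyReduces (gameLanguage i j) (edelweissLanguage i j) := by
  refine ⟨Stage.encode, Stage.continuous_encode, Set.ext fun t => ?_⟩
  obtain ⟨P, h₁, h₂⟩ := Stage.exists_wonBy_encode (by omega : 2 ≤ j) t
  change (edelGame (Stage.encode t)).ExistHasWinningStrategy ↔
    (treeGame t).ExistHasWinningStrategy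
  rw [← ParityGame.wonBy_exist_iff, ← ParityGame.wonBy_exist_iff]
  cases P with
  | exist => exact iff_of_true h₂ h₁
  | univ =>
    exact iff_of_false
      (fun h => ParityGame.not_wonBy_both _ (P := Player.exist) h h₂)
      (fun h => ParityGame.not_wonBy_both _ (P := Player.exist) h h₁)
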